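/- Let $f:\mathbb{C}\to\mathbb{C}$ be an almost periodic function in the whole plane $\mathbb{C}$; that is, $f$ is entire and, for all real numbers $a\le b$ and every $\varepsilon>0$, there is a number $l=l(a,b,\varepsilon)>0$ such that every open interval $(t_0,t_0+l)\subset\mathbb{R}$ of length $l$ contains a number $\tau$ with $$|f(s+i\tau)-f(s)|\le\varepsilon\qquad\text{for all } s\in\mathbb{C}\text{ with } a\le\operatorname{Re}s\le b .$$ The Fourier exponents of $f$ are the exponents that occur with a non-zero coefficient in its Dirichlet series $\sum_{n\ge1}a_ne^{\lambda_n s}$, i.e. the real numbers $\lambda$ for which the mean value $$\lim_{T\to\infty}\frac1{2T}\int_{-T}^{T}f(\sigma+it)\,e^{-\lambda(\sigma+it)}\,dt ,$$ which does not depend on $\sigma\in\mathbb{R}$, is non-zero. Suppose that $f$ has at least three (finitely or infinitely many) Fourier exponents and that they are linearly independent over $\mathbb{Q}$. Then the set $$R_f=\overline{\{\operatorname{Re}s : s\in\mathbb{C},\ f(s)=0\}}\subset\mathbb{R}$$ is non-empty; in other words, $f$ has at least one zero in $\mathbb{C}$. -/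

import Mathlib

open Filter Topology

noncomputable section

/-- The open interval of real numbers `σ` with `α < σ < β`, where `-∞ ≤ α` and `β ≤ ∞`. -/
def realInterval (α β : EReal) : Set ℝ :=
  {σ : ℝ | α < (σ : EReal) ∧ (σ : EReal) < β}

/-- The open vertical strip `{s : α < Re s < β}`; it is the whole plane for `α = ⊥`, `β = ⊤`. -/
def verticalStrip (α β : EReal) : Set ℂ :=
  {s : ℂ | s.re ∈ realInterval α β}

/-- `τ` is a translation number of `f` belonging to `ε` on the closed strip `a ≤ Re s ≤ b`. -/
def IsTranslationNumber (f : ℂ → ℂ) (a b ε τ : ℝ) : Prop :=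
  ∀ s : ℂ, s.re ∈ Set.Icc a b → ‖f (s + Complex.I * (τ : ℂ)) - f s‖ ≤ ε

/-- Bohr's analytic almost periodic functions in the strip `α < Re s < β`: `f` is analytic there
and, on every reduced strip `a ≤ Re s ≤ b` with `α < a ≤ b < β`, for every `ε > 0` its translation
numbers belonging to `ε` are relatively dense. -/
def IsAlmostPeriodicInStrip (α β : EReal) (f : ℂ → ℂ) : Prop :=
  DifferentiableOn ℂ f (verticalStrip α β) ∧
    ∀ a ∈ realInterval α β, ∀ b ∈ realInterval α β, a ≤ b →
      ∀ ε : ℝ, 0 < ε → ∃ l : ℝ, 0 < l ∧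
        ∀ t₀ : ℝ, ∃ τ ∈ Set.Ioo t₀ (t₀ + l), IsTranslationNumber f a b ε τ

/-- `c` is the coefficient of `exp (μ s)` in the Dirichlet series of `f`: on every vertical line
`Re s = σ` of the strip, `f (s) * exp (-μ s)` has mean value `c`. -/
def IsDirichletCoeff (α β : EReal) (f : ℂ → ℂ) (μ : ℝ) (c : ℂ) : Prop :=
  ∀ σ ∈ realInterval α β,
    Tendsto (fun T : ℝ => ((1 / (2 * T) : ℝ) : ℂ) *
      ∫ t in (-T)..T, f ((σ : ℂ) + Complex.I * (t : ℂ)) *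
        Complex.exp (-((μ : ℂ) * ((σ : ℂ) + Complex.I * (t : ℂ)))))
      atTop (𝓝 c)

/-- The Fourier exponents of `f`: the exponents with nonzero coefficient in its Dirichlet
series. -/
def fourierExponents (α β : EReal) (f : ℂ → ℂ) : Set ℝ :=
  {μ : ℝ | ∃ c : ℂ, c ≠ 0 ∧ IsDirichletCoeff α β f μ c}

/-- The set `R_f`: the closure of the set of real parts of the zeros of `f` in the strip,
intersected with the interval `(α, β)`. -/
def zeroProjectionSet (α β : EReal) (f : ℂ → ℂ) : Set ℝ :=
  closure {σ : ℝ | ∃ s ∈ verticalStrip α β, f s = 0 ∧ s.re = σ} ∩ realInterval α β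

end

open Filter Topology
open scoped BoundedContinuousFunction ComplexConjugate

noncomputable section

/-! Suppose `f` has no zero, and let `ν` and `μ` be two distinct exponents, `c` being the
coefficient at `ν`. Since the exponents are independent, the Dirichlet series converges absolutely
on every vertical line with sum `f` (Bohr). Kronecker's theorem then produces vertical translates of
`f` that approximate, uniformly on any closed strip of finite width, the function `f + (z - 1) c exp
(ν s)` for each `z` of modulus one (`exists_translate_near_rotate`). This limit is not identically
zero, because `f` has the exponent `μ` besides `ν`; by a Hurwitz argument it has no zeros
(`rotate_ne_zero`). Put `h = f / (c exp (ν s)) - 1`. A point with `‖h s‖ = 1` would be a zero of the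
rotation with `z = -h s`, so `‖h‖` never equals `1`. By connectedness `h` or `1 / h` is bounded, and
Liouville makes `h` constant. Then `f` is a multiple of `exp (ν s)`, which excludes the exponent `μ`
(`exists_zero`). Most of the work is the theory on the real line. The mean `bohrMean` is a limit
along an ultrafilter, so that it is a bounded linear functional on all bounded continuous functions;
on almost periodic ones it is the genuine limit. The uniqueness theorem is proved by Fourier series
on circles of growing length. Absolute summability comes from comparing a function on the line with
a trigonometric polynomial on a torus (`sum_norm_bohrMean_le`). -/

namespace AlmostPeriodic

/-! ### Translates and characters of bounded continuous functions. -/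

/-- The translate `t ↦ F (t + a)`. -/
def translate (a : ℝ) (F : ℝ →ᵇ ℂ) : ℝ →ᵇ ℂ :=
  F.compContinuous ⟨fun t => t + a, by fun_prop⟩

@[simp] lemma translate_apply (a : ℝ) (F : ℝ →ᵇ ℂ) (t : ℝ) : translate a F t = F (t + a) := rfl

@[simp] lemma translate_zero (F : ℝ →ᵇ ℂ) : translate 0 F = F := by ext; simp

lemma translate_sub (a : ℝ) (F G : ℝ →ᵇ ℂ) :
    translate a (F - G) = translate a F - translate a G := rfl

lemma translate_mul (a : ℝ) (F G : ℝ →ᵇ ℂ) :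
    translate a (F * G) = translate a F * translate a G := rfl

lemma translate_translate (a b : ℝ) (F : ℝ →ᵇ ℂ) :
    translate a (translate b F) = translate (a + b) F := by
  ext; simp [add_assoc]

lemma norm_translate_le (a : ℝ) (F : ℝ →ᵇ ℂ) : ‖translate a F‖ ≤ ‖F‖ :=
  (BoundedContinuousFunction.norm_le (norm_nonneg _)).2 fun _ => F.norm_coe_le_norm _

lemma norm_translate_sub_translate (a b c : ℝ) (F : ℝ →ᵇ ℂ) :
    ‖translate (c + a) F - translate (c + b) F‖ ≤ ‖translate a F - translate b F‖ := by
  rw [← translate_translate, ← translate_translate, ← translate_sub]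
  exact norm_translate_le _ _

lemma norm_apply_sub_le (F G : ℝ →ᵇ ℂ) (x : ℝ) : ‖F x - G x‖ ≤ ‖F - G‖ :=
  (F - G).norm_coe_le_norm x

/-- The bounded function `t ↦ exp (i μ t)`. -/
def character (μ : ℝ) : ℝ →ᵇ ℂ :=
  BoundedContinuousFunction.ofNormedAddCommGroup (fun t : ℝ => Complex.exp ((μ * t : ℝ) * Complex.I))
    (by fun_prop) 1 fun t => by rw [Complex.norm_exp_ofReal_mul_I]

lemma character_apply (μ t : ℝ) : character μ t = Complex.exp ((μ * t : ℝ) * Complex.I) := rfl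

@[simp] lemma norm_character_apply (μ t : ℝ) : ‖character μ t‖ = 1 := by
  rw [character_apply, Complex.norm_exp_ofReal_mul_I]

lemma norm_character_le (μ : ℝ) : ‖character μ‖ ≤ 1 :=
  (BoundedContinuousFunction.norm_le zero_le_one).2 fun t => (norm_character_apply μ t).le

lemma character_apply_add (μ s t : ℝ) :
    character μ (s + t) = character μ s * character μ t := by
  simp only [character_apply, ← Complex.exp_add]; congr 1; push_cast; ring

lemma character_mul (μ ν : ℝ) : character μ * character ν = character (μ + ν) := by
  ext t
  simp only [BoundedContinuousFunction.mul_apply, character_apply, ← Complex.exp_add]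
  congr 1; push_cast; ring

lemma character_zero : character 0 = 1 := by
  ext t; simp [character_apply]

lemma translate_character (a μ : ℝ) : translate a (character μ) = character μ a • character μ := by
  ext t; simp [character_apply_add, mul_comm]

/-! ### Averages over long intervals and the invariant mean. -/

/-- The average of `F` over the interval from `x` to `x + T`. -/
def average (T : ℝ) (F : ℝ →ᵇ ℂ) (x : ℝ) : ℂ := (T : ℂ)⁻¹ * ∫ t in (0 : ℝ)..T, F (x + t)

lemma intervalIntegrable_shift (F : ℝ →ᵇ ℂ) (x a b : ℝ) :
    IntervalIntegrable (fun t => F (x + t)) MeasureTheory.volume a b :=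
  (by fun_prop : Continuous fun t => F (x + t)).intervalIntegrable a b

lemma average_add (T : ℝ) (F G : ℝ →ᵇ ℂ) (x : ℝ) :
    average T (F + G) x = average T F x + average T G x := by
  simp only [average, BoundedContinuousFunction.add_apply]
  rw [intervalIntegral.integral_add (intervalIntegrable_shift F x 0 T)
    (intervalIntegrable_shift G x 0 T), mul_add]

lemma average_smul (T : ℝ) (c : ℂ) (F : ℝ →ᵇ ℂ) (x : ℝ) :
    average T (c • F) x = c * average T F x := by
  simp only [average, BoundedContinuousFunction.smul_apply, smul_eq_mul,
    intervalIntegral.integral_const_mul]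
  ring

lemma average_sub (T : ℝ) (F G : ℝ →ᵇ ℂ) (x : ℝ) :
    average T (F - G) x = average T F x - average T G x := by
  rw [sub_eq_add_neg, ← neg_one_smul ℂ G, average_add, average_smul]; ring

lemma average_translate (T a : ℝ) (F : ℝ →ᵇ ℂ) (x : ℝ) :
    average T (translate a F) x = average T F (x + a) := by
  simp only [average, translate_apply]
  congr 2; ext t; congr 1; ring

lemma norm_average_le_of_bound {T : ℝ} (hT : 0 < T) (F : ℝ →ᵇ ℂ) (x C : ℝ)
    (h : ∀ t, ‖F t‖ ≤ C) : ‖average T F x‖ ≤ C := by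
  have h1 : ‖∫ t in (0 : ℝ)..T, F (x + t)‖ ≤ C * |T - 0| :=
    intervalIntegral.norm_integral_le_of_norm_le_const fun t _ => h _
  rw [average, norm_mul, norm_inv, Complex.norm_real, Real.norm_of_nonneg hT.le]
  rw [sub_zero, abs_of_pos hT] at h1
  rw [inv_mul_le_iff₀ hT]; linarith

lemma norm_average_le {T : ℝ} (hT : 0 < T) (F : ℝ →ᵇ ℂ) (x : ℝ) : ‖average T F x‖ ≤ ‖F‖ :=
  norm_average_le_of_bound hT F x _ F.norm_coe_le_norm

lemma average_one {T : ℝ} (hT : 0 < T) (x : ℝ) : average T 1 x = 1 := by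
  have : (T : ℂ) ≠ 0 := by exact_mod_cast hT.ne'
  simp [average, this]

/-- The two windows differ only by two end pieces of length `|a|`. -/
lemma norm_average_shift_sub_le {T : ℝ} (hT : 0 < T) (F : ℝ →ᵇ ℂ) (x a : ℝ) :
    ‖average T F (x + a) - average T F x‖ ≤ 2 * |a| * ‖F‖ / T := by
  have hF : ∀ u v : ℝ, IntervalIntegrable F MeasureTheory.volume u v := fun u v =>
    F.continuous.intervalIntegrable u v
  have hb : ∀ u v : ℝ, ‖∫ t in u..v, F t‖ ≤ ‖F‖ * |v - u| := fun u v =>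
    intervalIntegral.norm_integral_le_of_norm_le_const fun t _ => F.norm_coe_le_norm t
  have e : average T F (x + a) - average T F x
      = (T : ℂ)⁻¹ * ((∫ t in (x + T)..(x + a + T), F t) - ∫ t in x..(x + a), F t) := by
    simp only [average, intervalIntegral.integral_comp_add_left, add_zero, ← mul_sub]
    congr 1
    rw [← intervalIntegral.integral_add_adjacent_intervals (hF (x + a) (x + T)) (hF (x + T) _),
      ← intervalIntegral.integral_add_adjacent_intervals (hF x (x + a)) (hF (x + a) (x + T))]
    ring
  rw [e, norm_mul, norm_inv, Complex.norm_real, Real.norm_of_nonneg hT.le, inv_mul_eq_div]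
  gcongr
  refine (norm_sub_le _ _).trans ((add_le_add (hb _ _) (hb _ _)).trans (le_of_eq ?_))
  have h1 : x + a + T - (x + T) = a := by ring
  have h2 : x + a - x = a := by ring
  rw [h1, h2]; ring

/-- Fubini. This symmetry is how averages over windows of different lengths are compared. -/
lemma average_average {T S : ℝ} (F : ℝ →ᵇ ℂ) (x : ℝ) :
    (S : ℂ)⁻¹ * ∫ a in (0 : ℝ)..S, average T F (x + a)
      = (T : ℂ)⁻¹ * ∫ a in (0 : ℝ)..T, average S F (x + a) := by
  simp only [average, intervalIntegral.integral_const_mul]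
  rw [mul_left_comm]
  congr 2
  rw [MeasureTheory.intervalIntegral_intervalIntegral_swap]
  · refine intervalIntegral.integral_congr fun t _ => intervalIntegral.integral_congr fun s _ => ?_
    rw [add_right_comm]
  · have hc : Continuous (Function.uncurry fun a t : ℝ => F (x + a + t)) := by fun_prop
    exact (hc.continuousOn.integrableOn_compact
      (isCompact_uIcc.prod isCompact_uIcc)).mono_set
        (Set.prod_mono Set.uIoc_subset_uIcc Set.uIoc_subset_uIcc)

/-- The averages over `[0, T]` converge along an ultrafilter of the `T` that tend to infinity. -/
lemma exists_tendsto_average (F : ℝ →ᵇ ℂ) : ∃ m : ℂ,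
    Tendsto (fun T => average T F 0) (Ultrafilter.of (atTop : Filter ℝ)) (𝓝 m) := by
  have h : ∀ᶠ T in (Ultrafilter.of (atTop : Filter ℝ) : Filter ℝ),
      average T F 0 ∈ Metric.closedBall (0 : ℂ) ‖F‖ :=
    (Ultrafilter.of_le atTop) ((eventually_gt_atTop 0).mono fun T hT => by
      simpa using norm_average_le hT F 0)
  obtain ⟨m, -, hm⟩ := (isCompact_closedBall (0 : ℂ) ‖F‖).ultrafilter_le_nhds
    ((Ultrafilter.of (atTop : Filter ℝ)).map fun T => average T F 0)
    (by rw [le_principal_iff]; exact h)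
  exact ⟨m, hm⟩

/-- An invariant mean of bounded functions, extending the limit of the averages over `[0, T]`. -/
def bohrMean : (ℝ →ᵇ ℂ) →L[ℂ] ℂ :=
  LinearMap.mkContinuous
    { toFun := fun F => (exists_tendsto_average F).choose
      map_add' := fun F G => tendsto_nhds_unique (exists_tendsto_average (F + G)).choose_spec
        (by simpa only [average_add] using
          (exists_tendsto_average F).choose_spec.add (exists_tendsto_average G).choose_spec)
      map_smul' := fun c F => tendsto_nhds_unique (exists_tendsto_average (c • F)).choose_spec
        (by simpa only [average_smul, RingHom.id_apply, smul_eq_mul] using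
          (exists_tendsto_average F).choose_spec.const_mul c) }
    1 fun F => by
      rw [one_mul]
      refine le_of_tendsto (exists_tendsto_average F).choose_spec.norm ?_
      exact (Ultrafilter.of_le atTop) ((eventually_gt_atTop 0).mono fun T hT =>
        norm_average_le hT F 0)

lemma tendsto_bohrMean (F : ℝ →ᵇ ℂ) :
    Tendsto (fun T => average T F 0) (Ultrafilter.of (atTop : Filter ℝ)) (𝓝 (bohrMean F)) :=
  (exists_tendsto_average F).choose_spec

lemma bohrMean_eq_of_tendsto {F : ℝ →ᵇ ℂ} {m : ℂ}
    (h : Tendsto (fun T => average T F 0) atTop (𝓝 m)) : bohrMean F = m :=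
  tendsto_nhds_unique (tendsto_bohrMean F) (h.mono_left (Ultrafilter.of_le atTop))

lemma norm_bohrMean_le (F : ℝ →ᵇ ℂ) : ‖bohrMean F‖ ≤ ‖F‖ :=
  le_of_tendsto (tendsto_bohrMean F).norm
    ((Ultrafilter.of_le atTop) ((eventually_gt_atTop 0).mono fun _ hT => norm_average_le hT F 0))

lemma bohrMean_one : bohrMean 1 = 1 :=
  bohrMean_eq_of_tendsto (tendsto_const_nhds.congr'
    ((eventually_gt_atTop 0).mono fun _ hT => (average_one hT 0).symm))

lemma bohrMean_translate (a : ℝ) (F : ℝ →ᵇ ℂ) : bohrMean (translate a F) = bohrMean F := by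
  refine tendsto_nhds_unique (tendsto_bohrMean _) ?_
  have h : Tendsto (fun T => average T (translate a F) 0 - average T F 0) atTop (𝓝 0) := by
    refine squeeze_zero_norm' (a := fun T => 2 * |a| * ‖F‖ / T)
      ((eventually_gt_atTop 0).mono fun T hT => ?_)
      (tendsto_const_nhds.div_atTop tendsto_id)
    rw [average_translate]; exact norm_average_shift_sub_le hT F 0 a
  simpa using (h.mono_left (Ultrafilter.of_le atTop)).add (tendsto_bohrMean F)

lemma le_re_bohrMean {F : ℝ →ᵇ ℂ} {c : ℝ} (h : ∀ t, c ≤ (F t).re) : c ≤ (bohrMean F).re := by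
  refine ge_of_tendsto ((Complex.continuous_re.tendsto _).comp (tendsto_bohrMean F))
    ((Ultrafilter.of_le atTop) ((eventually_gt_atTop 0).mono fun T hT => ?_))
  have hi : IntervalIntegrable (fun t => (F (0 + t)).re) MeasureTheory.volume 0 T :=
    Continuous.intervalIntegrable (by fun_prop) _ _
  have e : (average T F 0).re = T⁻¹ * ∫ t in (0 : ℝ)..T, (F (0 + t)).re := by
    rw [average, ← Complex.ofReal_inv, Complex.re_ofReal_mul]
    congr 1
    exact (Complex.reCLM.intervalIntegral_comp_comm (intervalIntegrable_shift F 0 0 T)).symm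
  simp only [Function.comp_apply, e]
  rw [le_inv_mul_iff₀ hT]
  have := intervalIntegral.integral_mono_on hT.le (intervalIntegrable_const (c := c)) hi
    fun t _ => h _
  simpa using this

lemma bohrMean_character {μ : ℝ} (hμ : μ ≠ 0) : bohrMean (character μ) = 0 := by
  refine bohrMean_eq_of_tendsto ?_
  refine squeeze_zero_norm' (a := fun T => (2 / |μ|) / T)
    ((eventually_gt_atTop 0).mono fun T hT => ?_) (tendsto_const_nhds.div_atTop tendsto_id)
  have hc : (μ * Complex.I : ℂ) ≠ 0 := by simp [hμ]
  have e : ∫ t in (0 : ℝ)..T, character μ (0 + t)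
      = (character μ T - 1) / (μ * Complex.I) := by
    have : ∀ t : ℝ, character μ (0 + t) = Complex.exp ((μ * Complex.I) * t) := fun t => by
      rw [character_apply]; congr 1; push_cast; ring
    simp only [this, integral_exp_mul_complex hc]
    simp [character_apply]; ring_nf
  rw [average, e, norm_mul, norm_inv, Complex.norm_real, Real.norm_of_nonneg hT.le, norm_div,
    inv_mul_eq_div]
  gcongr
  · exact (norm_sub_le _ _).trans (by norm_num)
  · simp

/-! ### Almost periodic functions on the line and their mean values. -/

/-- Bochner's form of almost periodicity: the translates depend continuously on the shift and form
a totally bounded set in the supremum norm. -/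
def IsAP (F : ℝ →ᵇ ℂ) : Prop :=
  Continuous (fun a => translate a F) ∧ TotallyBounded (Set.range fun a => translate a F)

lemma IsAP.exists_finset {F : ℝ →ᵇ ℂ} (hF : IsAP F) {ε : ℝ} (hε : 0 < ε) :
    ∃ s : Finset ℝ, ∀ a, ∃ b ∈ s, ‖translate a F - translate b F‖ < ε := by
  obtain ⟨t, hts, htf, ht⟩ := Metric.finite_approx_of_totallyBounded hF.2 ε hε
  have hch : ∀ G ∈ t, ∃ b, translate b F = G := fun G hG => hts hG
  choose! g hg using hch
  refine ⟨htf.toFinset.image g, fun a => ?_⟩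
  obtain ⟨G, hG, hd⟩ := Set.mem_iUnion₂.1 (ht ⟨a, rfl⟩)
  refine ⟨g G, Finset.mem_image_of_mem _ (htf.mem_toFinset.2 hG), ?_⟩
  rw [hg G hG, ← dist_eq_norm]; exact hd

lemma IsAP.of_forall_exists {F : ℝ →ᵇ ℂ}
    (h : ∀ ε > 0, ∃ G : ℝ →ᵇ ℂ, IsAP G ∧ ‖F - G‖ < ε) : IsAP F := by
  constructor
  · refine Metric.continuous_iff.2 fun b ε hε => ?_
    obtain ⟨G, hG, hd⟩ := h (ε / 3) (by positivity)
    obtain ⟨δ, hδ, hc⟩ := Metric.continuous_iff.1 hG.1 b (ε / 3) (by positivity)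
    refine ⟨δ, hδ, fun a ha => ?_⟩
    have h1 := hc a ha
    have h2 := norm_translate_le a (F - G)
    have h3 := norm_translate_le b (F - G)
    rw [dist_eq_norm] at h1 ⊢
    have e : translate a F - translate b F = translate a (F - G)
        + (translate a G - translate b G) - translate b (F - G) := by
      simp only [translate_sub]; abel
    rw [e]
    have := norm_sub_le (translate a (F - G) + (translate a G - translate b G))
      (translate b (F - G))
    have := norm_add_le (translate a (F - G)) (translate a G - translate b G)
    linarith
  · refine Metric.totallyBounded_iff.2 fun ε hε => ?_
    obtain ⟨G, hG, hd⟩ := h (ε / 2) (by positivity)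
    obtain ⟨t, htf, ht⟩ := Metric.totallyBounded_iff.1 hG.2 (ε / 2) (by positivity)
    refine ⟨t, htf, ?_⟩
    rintro _ ⟨a, rfl⟩
    obtain ⟨H, hH, hdist⟩ := Set.mem_iUnion₂.1 (ht ⟨a, rfl⟩)
    refine Set.mem_iUnion₂.2 ⟨H, hH, ?_⟩
    have h2 := norm_translate_le a (F - G)
    rw [translate_sub, ← dist_eq_norm] at h2
    have := dist_triangle (translate a F) (translate a G) H
    rw [Metric.mem_ball] at hdist ⊢
    linarith

/-- The orbit of `H` lies in the continuous image of the product of two compact orbit closures. All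
algebraic closure properties follow. -/
lemma IsAP.map₂ {F G H : ℝ →ᵇ ℂ} (hF : IsAP F) (hG : IsAP G)
    {Φ : (ℝ →ᵇ ℂ) × (ℝ →ᵇ ℂ) → (ℝ →ᵇ ℂ)} (hΦ : Continuous Φ)
    (h : ∀ a, translate a H = Φ (translate a F, translate a G)) : IsAP H := by
  constructor
  · simp only [h]; exact hΦ.comp (hF.1.prodMk hG.1)
  · have hK := ((isCompact_iff_totallyBounded_isComplete.2
      ⟨hF.2.closure, isClosed_closure.isComplete⟩).prod
      (isCompact_iff_totallyBounded_isComplete.2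
      ⟨hG.2.closure, isClosed_closure.isComplete⟩)).image hΦ
    refine hK.totallyBounded.subset ?_
    rintro _ ⟨a, rfl⟩
    exact ⟨(translate a F, translate a G),
      ⟨subset_closure ⟨a, rfl⟩, subset_closure ⟨a, rfl⟩⟩, (h a).symm⟩

lemma IsAP.add {F G : ℝ →ᵇ ℂ} (hF : IsAP F) (hG : IsAP G) : IsAP (F + G) :=
  hF.map₂ hG continuous_add fun _ => rfl

lemma IsAP.sub {F G : ℝ →ᵇ ℂ} (hF : IsAP F) (hG : IsAP G) : IsAP (F - G) :=
  hF.map₂ hG continuous_sub fun _ => rfl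

lemma IsAP.mul {F G : ℝ →ᵇ ℂ} (hF : IsAP F) (hG : IsAP G) : IsAP (F * G) :=
  hF.map₂ hG continuous_mul fun _ => rfl

lemma IsAP.smul {F : ℝ →ᵇ ℂ} (hF : IsAP F) (c : ℂ) : IsAP (c • F) :=
  hF.map₂ hF (Φ := fun p => c • p.1) (by fun_prop) fun _ => rfl

lemma IsAP.conj {F : ℝ →ᵇ ℂ} (hF : IsAP F) : IsAP (star F) :=
  hF.map₂ hF (Φ := fun p => Star.star p.1) (by fun_prop) fun _ => rfl

lemma isAP_character (μ : ℝ) : IsAP (character μ) := by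
  constructor
  · simp only [translate_character]
    fun_prop
  · refine (((isCompact_closedBall (0 : ℂ) 1).image
      (f := fun c : ℂ => c • character μ) (by fun_prop)).totallyBounded).subset ?_
    rintro _ ⟨a, rfl⟩
    exact ⟨character μ a, by simp, (translate_character a μ).symm⟩

lemma IsAP.sum {ι : Type*} (s : Finset ι) {F : ι → ℝ →ᵇ ℂ} (h : ∀ i ∈ s, IsAP (F i)) :
    IsAP (∑ i ∈ s, F i) := by
  classical
  induction s using Finset.induction_on with
  | empty =>
    have h0 := (isAP_character 0).smul 0
    rwa [zero_smul] at h0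
  | insert i s hi ih =>
    rw [Finset.sum_insert hi]
    exact (h i (Finset.mem_insert_self _ _)).add
      (ih fun j hj => h j (Finset.mem_insert_of_mem hj))

/-- The averages of an almost periodic function over intervals of length `T` are almost constant
for large `T`. -/
lemma IsAP.eventually_norm_average_sub_le {F : ℝ →ᵇ ℂ} (hF : IsAP F) {ε : ℝ} (hε : 0 < ε) :
    ∀ᶠ T in atTop, ∀ x a, ‖average T F (x + a) - average T F x‖ ≤ ε := by
  obtain ⟨s, hs⟩ := hF.exists_finset (half_pos hε)
  have h1 : ∀ b ∈ s, ∀ᶠ T : ℝ in atTop, 2 * |b| * ‖F‖ / T < ε / 2 := fun b _ =>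
    (tendsto_const_nhds.div_atTop tendsto_id).eventually_lt_const (half_pos hε)
  filter_upwards [(Filter.eventually_all_finset s).2 h1, eventually_gt_atTop 0] with T hT hT0 x a
  obtain ⟨b, hb, hab⟩ := hs a
  have h2 := norm_average_shift_sub_le hT0 F x b
  have h3 := norm_average_le hT0 (translate a F - translate b F) x
  rw [average_sub, average_translate, average_translate] at h3
  have := hT b hb
  have e : average T F (x + a) - average T F x
    = (average T F (x + a) - average T F (x + b)) + (average T F (x + b) - average T F x) := by ring
  rw [e]
  exact (norm_add_le _ _).trans (by linarith)

lemma continuous_average (T : ℝ) (F : ℝ →ᵇ ℂ) : Continuous (average T F) := by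
  unfold average
  have : Continuous fun x => ∫ t in (0 : ℝ)..T, F (x + t) :=
    intervalIntegral.continuous_parametric_intervalIntegral_of_continuous' (by fun_prop) _ _
  fun_prop

lemma norm_average_average_sub_le {S T δ : ℝ} (hS : 0 < S) {F : ℝ →ᵇ ℂ} {x : ℝ}
    (h : ∀ a ∈ Set.Icc 0 S, ‖average T F (x + a) - average T F x‖ ≤ δ) :
    ‖(S : ℂ)⁻¹ * (∫ a in (0 : ℝ)..S, average T F (x + a)) - average T F x‖ ≤ δ := by
  have hS' : (S : ℂ) ≠ 0 := by exact_mod_cast hS.ne'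
  have hc := continuous_average T F
  have e : (S : ℂ)⁻¹ * (∫ a in (0 : ℝ)..S, average T F (x + a)) - average T F x
      = (S : ℂ)⁻¹ * ∫ a in (0 : ℝ)..S, (average T F (x + a) - average T F x) := by
    rw [intervalIntegral.integral_sub (Continuous.intervalIntegrable (by fun_prop) _ _)
      (by simp), intervalIntegral.integral_const, mul_sub]
    simp [hS']
  have h1 : ‖∫ a in (0 : ℝ)..S, (average T F (x + a) - average T F x)‖ ≤ δ * |S - 0| := by
    refine intervalIntegral.norm_integral_le_of_norm_le_const fun a ha => h a ?_
    rw [Set.uIoc_of_le hS.le] at ha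
    exact Set.Ioc_subset_Icc_self ha
  rw [sub_zero, abs_of_pos hS] at h1
  rw [e, norm_mul, norm_inv, Complex.norm_real, Real.norm_of_nonneg hS.le, inv_mul_le_iff₀ hS]
  linarith

/-- Each of the two averages is within `δ` of the double average, which is symmetric in `S` and `T`
by `average_average`. -/
lemma norm_average_sub_average_le {S T δ : ℝ} (hS : 0 < S) (hT : 0 < T) {F : ℝ →ᵇ ℂ}
    (hTδ : ∀ x a, ‖average T F (x + a) - average T F x‖ ≤ δ)
    (hSδ : ∀ x a, ‖average S F (x + a) - average S F x‖ ≤ δ) (x : ℝ) :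
    ‖average T F x - average S F x‖ ≤ 2 * δ := by
  have h1 := norm_average_average_sub_le hS fun a _ => hTδ x a
  have h2 := norm_average_average_sub_le hT fun a _ => hSδ x a
  rw [average_average] at h1
  have := norm_sub_le_norm_sub_add_norm_sub (average T F x)
    ((T : ℂ)⁻¹ * ∫ a in (0 : ℝ)..T, average S F (x + a)) (average S F x)
  rw [norm_sub_rev] at h1
  linarith

/-- **Mean value theorem** for almost periodic functions: the averages over intervals of length `T`
converge uniformly. -/
theorem IsAP.eventually_norm_average_sub_bohrMean_le {F : ℝ →ᵇ ℂ} (hF : IsAP F) {ε : ℝ}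
    (hε : 0 < ε) : ∀ᶠ T in atTop, ∀ x, ‖average T F x - bohrMean F‖ ≤ ε := by
  have hev : ∀ δ > 0, ∀ᶠ T in atTop, 0 < T ∧ ∀ x a, ‖average T F (x + a) - average T F x‖ ≤ δ :=
    fun δ hδ => (eventually_gt_atTop 0).and (hF.eventually_norm_average_sub_le hδ)
  -- Letting `S` run along the ultrafilter in the two-length estimate replaces the average over `S`
  -- by the mean.
  have hlim : ∀ T, 0 < T → ∀ δ > 0, (∀ x a, ‖average T F (x + a) - average T F x‖ ≤ δ) →
      ‖average T F 0 - bohrMean F‖ ≤ 2 * δ := by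
    intro T hT δ hδ h
    refine le_of_tendsto ((tendsto_const_nhds.sub (tendsto_bohrMean F)).norm)
      ((Ultrafilter.of_le atTop) ((hev δ hδ).mono fun S hS => ?_))
    exact norm_average_sub_average_le hS.1 hT h hS.2 0
  filter_upwards [hev (ε / 3) (by positivity)] with T hT x
  have h1 := hlim T hT.1 _ (by positivity) hT.2
  have h2 := hT.2 0 x
  rw [zero_add] at h2
  have := norm_sub_le_norm_sub_add_norm_sub (average T F x) (average T F 0) (bohrMean F)
  linarith

/-- The symmetric averages of an almost periodic function converge to its mean value. -/
lemma IsAP.tendsto_symmetric_average {F : ℝ →ᵇ ℂ} (hF : IsAP F) :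
    Tendsto (fun T : ℝ => ((1 / (2 * T) : ℝ) : ℂ) * ∫ t in (-T)..T, F t) atTop
      (𝓝 (bohrMean F)) := by
  refine Metric.tendsto_nhds.2 fun ε hε => ?_
  have h2 : Tendsto (fun T : ℝ => 2 * T) atTop atTop :=
    tendsto_id.const_mul_atTop (by norm_num)
  filter_upwards [h2.eventually (hF.eventually_norm_average_sub_bohrMean_le (half_pos hε))]
    with T hT
  have := hT (-T)
  rw [average, intervalIntegral.integral_comp_add_left] at this
  rw [dist_eq_norm]
  have e1 : -T + 0 = -T := by ring
  have e2 : -T + 2 * T = T := by ring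
  rw [e1, e2] at this
  have e3 : ((2 * T : ℝ) : ℂ)⁻¹ = ((1 / (2 * T) : ℝ) : ℂ) := by push_cast; ring
  rw [e3] at this
  linarith

/-- An almost periodic function with vanishing mean square vanishes. -/
lemma IsAP.eq_zero_of_bohrMean_eq_zero {F : ℝ →ᵇ ℂ} (hF : IsAP F)
    (h : bohrMean (F * star F) = 0) : F = 0 := by
  by_contra hne
  obtain ⟨x, hx⟩ : ∃ x, F x ≠ 0 := by
    by_contra! h0; exact hne (by ext y; exact h0 y)
  have hx' : 0 < ‖F x‖ := norm_pos_iff.2 hx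
  obtain ⟨s, hs⟩ := hF.exists_finset (half_pos hx')
  -- If translation by `t` is close to translation by `b`, then `F (t + (x - b))` is close to `F x`.
  -- So finitely many translates of `|F| ^ 2` have a sum bounded below by a positive constant, while
  -- its mean would be zero.
  have hle : ∀ t, (‖F x‖ / 2) ^ 2 ≤ ((∑ b ∈ s, translate (x - b) (F * star F)) t).re := by
    intro t
    obtain ⟨b, hb, hab⟩ := hs t
    have h1 : ‖F x‖ / 2 ≤ ‖F (t + (x - b))‖ := by
      have h2 := (norm_apply_sub_le (translate t F) (translate b F) (x - b)).trans hab.le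
      simp only [translate_apply, sub_add_cancel] at h2
      have h3 := norm_sub_norm_le (F x) (F (t + (x - b)))
      rw [norm_sub_rev, add_comm t] at h3
      rw [add_comm t]
      linarith
    have h4 : ∀ b, ((translate (x - b) (F * star F)) t).re = ‖F (t + (x - b))‖ ^ 2 := fun b => by
      simp only [translate_apply, BoundedContinuousFunction.mul_apply,
        BoundedContinuousFunction.star_apply, RCLike.star_def, Complex.mul_conj,
        Complex.normSq_eq_norm_sq, Complex.ofReal_re]
    rw [BoundedContinuousFunction.sum_apply, Complex.re_sum]
    simp only [h4]
    refine (pow_le_pow_left₀ (by positivity) h1 2).trans ?_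
    exact Finset.single_le_sum (f := fun b => ‖F (t + (x - b))‖ ^ 2)
      (fun _ _ => by positivity) hb
  have := le_re_bohrMean hle
  rw [map_sum] at this
  simp only [bohrMean_translate, h, Finset.sum_const_zero, Complex.zero_re] at this
  have : 0 < (‖F x‖ / 2) ^ 2 := by positivity
  linarith

/-! ### Averages against characters, uniformly in the frequency. -/

/-- Riemann–Lebesgue argument: the shift by `π / μ` changes the sign of the character but hardly
changes `F`, so twice the average is a sum of two small errors. -/
lemma norm_average_character_mul_le_of_large {F : ℝ →ᵇ ℂ} {ε δ T μ : ℝ} (hT : 0 < T) (hδ : 0 < δ)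
    (hF : ∀ h, |h| ≤ δ → ‖translate h F - F‖ ≤ ε) (hTδ : 2 * δ * ‖F‖ / T ≤ ε)
    (hμ : Real.pi / δ ≤ |μ|) (x : ℝ) : ‖average T (character μ * F) x‖ ≤ ε := by
  have hμ0 : 0 < |μ| := lt_of_lt_of_le (by positivity) hμ
  have hμ1 : μ ≠ 0 := abs_pos.1 hμ0
  set h := Real.pi / μ with hh
  have hle : |h| ≤ δ := by
    rw [hh, abs_div, abs_of_pos Real.pi_pos]
    rw [div_le_iff₀ hδ] at hμ
    rw [div_le_iff₀ hμ0]; linarith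
  have hch : character μ h = -1 := by
    rw [character_apply, hh, mul_div_cancel₀ _ hμ1, Complex.exp_pi_mul_I]
  have hnorm : ∀ G : ℝ →ᵇ ℂ, ‖character μ * G‖ ≤ ‖G‖ := fun G =>
    (norm_mul_le _ _).trans (mul_le_of_le_one_left (norm_nonneg _) (norm_character_le μ))
  have e1 : average T (character μ * F) (x + h)
      = -average T (character μ * translate h F) x := by
    rw [← average_translate, translate_mul, translate_character, hch, smul_mul_assoc,
      average_smul]; ring
  have e2 : average T (character μ * (translate h F - F)) x
      = average T (character μ * translate h F) x - average T (character μ * F) x := by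
    rw [mul_sub, average_sub]
  have h1 := norm_average_shift_sub_le hT (character μ * F) x h
  have h2 := (norm_average_le hT (character μ * (translate h F - F)) x).trans
    ((hnorm _).trans (hF h hle))
  have h3 : 2 * |h| * ‖character μ * F‖ / T ≤ ε := by
    refine le_trans ?_ hTδ
    gcongr
    exact hnorm F
  have e3 : 2 * average T (character μ * F) x
      = -(average T (character μ * F) (x + h) - average T (character μ * F) x)
        - average T (character μ * (translate h F - F)) x := by
    rw [e1, e2]; ring
  have h4 : ‖2 * average T (character μ * F) x‖ ≤ ε + ε := by
    rw [e3]
    refine (norm_sub_le _ _).trans (add_le_add ?_ h2)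
    rw [norm_neg]; exact h1.trans h3
  rw [norm_mul, Complex.norm_ofNat] at h4
  linarith

lemma norm_character_sub_le (μ ν t : ℝ) : ‖character μ t - character ν t‖ ≤ |μ - ν| * |t| := by
  have e : character μ t - character ν t = character ν t * (character (μ - ν) t - 1) := by
    have : character μ t = character ν t * character (μ - ν) t := by
      rw [← BoundedContinuousFunction.mul_apply, character_mul]; ring_nf
    rw [this]; ring
  rw [e, norm_mul, norm_character_apply, one_mul, character_apply, mul_comm _ Complex.I,
    ← abs_mul]
  exact Real.norm_exp_I_mul_ofReal_sub_one_le

/-- Pulling out the unimodular factor `character μ x` moves the window to `[0, S]`, where the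
characters differ by at most `|μ - ν| * S`; hence the bound is uniform in `x`. -/
lemma norm_average_character_mul_le_add {F : ℝ →ᵇ ℂ} {S : ℝ} (hS : 0 < S) (μ ν x : ℝ) :
    ‖average S (character μ * F) x‖
      ≤ ‖average S (character ν * F) x‖ + |μ - ν| * S * ‖F‖ := by
  have e : ∀ ξ, ‖average S (character ξ * F) x‖
      = ‖(S : ℂ)⁻¹ * ∫ t in (0 : ℝ)..S, character ξ t * F (x + t)‖ := fun ξ => by
    simp only [average, BoundedContinuousFunction.mul_apply, character_apply_add, mul_assoc]
    rw [intervalIntegral.integral_const_mul, mul_left_comm, norm_mul, norm_character_apply,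
      one_mul]
  rw [e, e]
  have h1 : ‖∫ t in (0 : ℝ)..S, (character μ t * F (x + t) - character ν t * F (x + t))‖
      ≤ |μ - ν| * S * ‖F‖ * |S - 0| := by
    refine intervalIntegral.norm_integral_le_of_norm_le_const fun t ht => ?_
    rw [Set.uIoc_of_le hS.le] at ht
    rw [← sub_mul, norm_mul]
    have := norm_character_sub_le μ ν t
    have ht' : |t| ≤ S := by rw [abs_of_pos ht.1]; exact ht.2
    gcongr
    · exact this.trans (by gcongr)
    · exact F.norm_coe_le_norm _
  rw [sub_zero, abs_of_pos hS] at h1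
  rw [← sub_le_iff_le_add']
  refine (norm_sub_norm_le _ _).trans ?_
  rw [← mul_sub, ← intervalIntegral.integral_sub
    (Continuous.intervalIntegrable (by fun_prop) _ _)
    (Continuous.intervalIntegrable (by fun_prop) _ _), norm_mul, norm_inv, Complex.norm_real,
    Real.norm_of_nonneg hS.le, inv_mul_le_iff₀ hS]
  linarith

/-- If all Fourier coefficients of an almost periodic function vanish, then its averages over
intervals of length `T` against characters tend to zero uniformly in the frequency. -/
theorem IsAP.eventually_norm_average_character_mul_le {F : ℝ →ᵇ ℂ} (hF : IsAP F)
    (h0 : ∀ μ, bohrMean (character μ * F) = 0) {ε : ℝ} (hε : 0 < ε) :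
    ∀ᶠ T in atTop, ∀ μ x, ‖average T (character μ * F) x‖ ≤ ε := by
  obtain ⟨δ, hδ, hc⟩ := Metric.continuous_iff.1 hF.1 0 ε hε
  have hc' : ∀ h, |h| ≤ δ / 2 → ‖translate h F - F‖ ≤ ε := fun h hh => by
    have := hc h (by rw [Real.dist_eq, sub_zero]; linarith)
    rw [translate_zero, dist_eq_norm] at this
    exact this.le
  -- Frequencies beyond this interval fall under the Riemann–Lebesgue bound. Inside it, compactness
  -- reduces the claim to a neighbourhood of each `ν`.
  have hcompact : ∀ᶠ T in atTop, ∀ μ ∈ Set.Icc (-(Real.pi / (δ / 2))) (Real.pi / (δ / 2)), ∀ x,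
      ‖average T (character μ * F) x‖ ≤ ε := by
    refine isCompact_Icc.induction_on
      (p := fun s => ∀ᶠ T in atTop, ∀ μ ∈ s, ∀ x, ‖average T (character μ * F) x‖ ≤ ε)
      (by simp) (fun s t hst h => h.mono fun T hT μ hμ => hT μ (hst hμ))
      (fun s t hs ht => ?_) fun ν _ => ?_
    · filter_upwards [hs, ht] with T h1 h2 μ hμ
      exact hμ.elim (h1 μ) (h2 μ)
    · have hAP := (isAP_character ν).mul hF
      -- The length `S` is fixed for `ν` alone and works for nearby `μ`; averages over long `T` are
      -- then controlled as averages of averages over `S`.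
      obtain ⟨S, hS, hS0⟩ := ((hAP.eventually_norm_average_sub_bohrMean_le
        (ε := ε / 3) (by positivity)).and (eventually_gt_atTop 0)).exists
      rw [h0] at hS
      have hnhds : ∀ᶠ μ in 𝓝 ν, |μ - ν| * S * ‖F‖ < ε / 3 := by
        have : Tendsto (fun μ => |μ - ν| * S * ‖F‖) (𝓝 ν) (𝓝 (|ν - ν| * S * ‖F‖)) :=
          Continuous.tendsto (by fun_prop) ν
        refine this.eventually_lt_const ?_
        simp; positivity
      refine ⟨_, mem_nhdsWithin_of_mem_nhds hnhds, ?_⟩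
      have hT : ∀ᶠ T : ℝ in atTop, 2 * S * ‖F‖ / T < ε / 3 :=
        (tendsto_const_nhds.div_atTop tendsto_id).eventually_lt_const (by positivity)
      filter_upwards [hT, eventually_gt_atTop 0] with T hT hT0 μ hμ x
      have hμ' : |μ - ν| * S * ‖F‖ < ε / 3 := hμ
      have hb : ∀ y, ‖average S (character μ * F) y‖ ≤ 2 * ε / 3 := fun y => by
        have h1 := hS y
        rw [sub_zero] at h1
        have := norm_average_character_mul_le_add (F := F) hS0 μ ν y
        linarith
      have hnorm : ‖character μ * F‖ ≤ ‖F‖ :=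
        (norm_mul_le _ _).trans (mul_le_of_le_one_left (norm_nonneg _) (norm_character_le μ))
      have h2 := norm_average_average_sub_le (T := T) (F := character μ * F) (x := x) hS0
        (δ := ε / 3) fun a ha => by
          refine (norm_average_shift_sub_le hT0 _ x a).trans (le_trans ?_ hT.le)
          rw [abs_of_nonneg ha.1]
          gcongr
          exact ha.2
      rw [average_average] at h2
      have h3 : ‖(T : ℂ)⁻¹ * ∫ a in (0 : ℝ)..T, average S (character μ * F) (x + a)‖
          ≤ 2 * ε / 3 := by
        have h4 : ‖∫ a in (0 : ℝ)..T, average S (character μ * F) (x + a)‖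
            ≤ 2 * ε / 3 * |T - 0| :=
          intervalIntegral.norm_integral_le_of_norm_le_const fun a _ => hb _
        rw [sub_zero, abs_of_pos hT0] at h4
        rw [norm_mul, norm_inv, Complex.norm_real, Real.norm_of_nonneg hT0.le,
          inv_mul_le_iff₀ hT0]
        linarith
      rw [norm_sub_rev] at h2
      have := norm_sub_norm_le (average T (character μ * F) x)
        ((T : ℂ)⁻¹ * ∫ a in (0 : ℝ)..T, average S (character μ * F) (x + a))
      linarith
  have hT : ∀ᶠ T : ℝ in atTop, 2 * (δ / 2) * ‖F‖ / T < ε :=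
    (tendsto_const_nhds.div_atTop tendsto_id).eventually_lt_const hε
  filter_upwards [hcompact, hT, eventually_gt_atTop 0] with T h1 h2 hT0 μ x
  rcases le_total |μ| (Real.pi / (δ / 2)) with h | h
  · exact h1 μ (abs_le.1 h) x
  · exact norm_average_character_mul_le_of_large hT0 (half_pos hδ) hc' h2.le h x

/-! ### Fourier series on a circle: Parseval and autocorrelation. -/

section Circle

open MeasureTheory AddCircle

variable {L : ℝ} [hL : Fact (0 < L)]

lemma memLp_two_of_bounded {u : AddCircle L → ℂ} (hu : Measurable u) {C : ℝ}
    (hC : ∀ t, ‖u t‖ ≤ C) : MemLp u 2 haarAddCircle :=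
  MemLp.of_bound hu.aestronglyMeasurable C (Eventually.of_forall hC)

lemma fourierCoeff_comp_add_right (u : AddCircle L → ℂ) (x : AddCircle L) (n : ℤ) :
    fourierCoeff (fun t => u (t + x)) n = fourier n x * fourierCoeff u n := by
  unfold fourierCoeff
  rw [← integral_add_right_eq_self (fun t => fourier (-n) t • u t) x, ← integral_const_mul]
  congr 1; ext t
  have h : fourier n x * fourier (-n) x = (1 : ℂ) := by
    rw [← fourier_add]; simp
  rw [smul_eq_mul, smul_eq_mul]
  have : fourier (-n) (t + x) = fourier (-n) t * fourier (-n) x := by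
    simp only [fourier_apply, smul_add, toCircle_add, Circle.coe_mul]
  rw [this]
  linear_combination (fourier (-n) t * u (t + x)) * (-h)

lemma hasSum_sq_fourierCoeff_of_bounded {u : AddCircle L → ℂ} (hu : Measurable u) {C : ℝ}
    (hC : ∀ t, ‖u t‖ ≤ C) :
    Summable (fun n => ‖fourierCoeff u n‖ ^ 2) ∧ ∑' n, ‖fourierCoeff u n‖ ^ 2 ≤ C ^ 2 := by
  have hm := memLp_two_of_bounded hu hC
  have h := hasSum_sq_fourierCoeff hm.toLp
  simp only [fourierCoeff_congr_ae hm.coeFn_toLp] at h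
  refine ⟨h.summable, h.tsum_eq.le.trans ?_⟩
  have h1 : ∫ t, ‖hm.toLp u t‖ ^ 2 ∂haarAddCircle ≤ ∫ _ : AddCircle L, C ^ 2 ∂haarAddCircle := by
    refine integral_mono_of_nonneg (Eventually.of_forall fun t => by positivity)
      (integrable_const _) ?_
    filter_upwards [hm.coeFn_toLp] with t ht
    rw [ht]
    exact pow_le_pow_left₀ (norm_nonneg _) (hC t) 2
  simpa using h1

/-- Parseval for `u` and its translate, whose coefficients differ by the factor `fourier n x`. -/
lemma hasSum_autocorrelation {u : AddCircle L → ℂ} (hu : Measurable u) {C : ℝ}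
    (hC : ∀ t, ‖u t‖ ≤ C) (x : AddCircle L) :
    HasSum (fun n : ℤ => ((‖fourierCoeff u n‖ ^ 2 : ℝ) : ℂ) * fourier n x)
      (∫ t, conj (u t) * u (t + x) ∂haarAddCircle) := by
  have hm := memLp_two_of_bounded hu hC
  have hux : Measurable fun t => u (t + x) := hu.comp (measurable_add_const x)
  have hmx := memLp_two_of_bounded hux (fun t => hC (t + x))
  have h := fourierBasis.hasSum_inner_mul_inner hm.toLp hmx.toLp
  have e1 : inner ℂ hm.toLp hmx.toLp = ∫ t, conj (u t) * u (t + x) ∂haarAddCircle := by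
    rw [L2.inner_def]
    refine integral_congr_ae ?_
    filter_upwards [hm.coeFn_toLp, hmx.coeFn_toLp] with t h1 h2
    rw [h1, h2, RCLike.inner_apply']
  have e2 : ∀ {v : AddCircle L → ℂ} (hv : MemLp v 2 haarAddCircle) (n : ℤ),
      inner ℂ (fourierBasis n) hv.toLp = fourierCoeff v n := fun hv n => by
    rw [← fourierCoeff_congr_ae hv.coeFn_toLp, ← fourierBasis_repr, fourierBasis.repr_apply_apply]
  rw [e1] at h
  refine (congrArg (fun g : ℤ → ℂ => HasSum g _) (funext fun n => ?_)).mpr h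
  rw [e2 hmx, ← inner_conj_symm, e2 hm, fourierCoeff_comp_add_right]
  have : ((‖fourierCoeff u n‖ ^ 2 : ℝ) : ℂ) = conj (fourierCoeff u n) * fourierCoeff u n := by
    rw [mul_comm, Complex.mul_conj, Complex.normSq_eq_norm_sq]
  rw [this]; ring

/-- If the Fourier coefficients of `u` are bounded by `b`, then the mean square of the
autocorrelation of `u` is at most `b ^ 2` times the square of a bound for `u`. -/
lemma integral_norm_sq_autocorrelation_le {u : AddCircle L → ℂ} (hu : Measurable u) {b C : ℝ}
    (hC : ∀ t, ‖u t‖ ≤ C) (hb : ∀ n, ‖fourierCoeff u n‖ ≤ b) :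
    Continuous (fun x => ∫ t, conj (u t) * u (t + x) ∂haarAddCircle) ∧
    ∫ x, ‖∫ t, conj (u t) * u (t + x) ∂haarAddCircle‖ ^ 2 ∂haarAddCircle ≤ b ^ 2 * C ^ 2 := by
  obtain ⟨hs, hle⟩ := hasSum_sq_fourierCoeff_of_bounded hu hC
  set a : ℤ → ℝ := fun n => ‖fourierCoeff u n‖ ^ 2 with ha
  have hsum : Summable fun n : ℤ => (a n : ℂ) • (fourier n : C(AddCircle L, ℂ)) := by
    refine Summable.of_norm ?_
    simpa [norm_smul, fourier_norm, ha] using hs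
  obtain ⟨c, hc⟩ := hsum
  have hcx : ∀ x, c x = ∫ t, conj (u t) * u (t + x) ∂haarAddCircle := fun x =>
    (hc.mapL (ContinuousMap.evalCLM ℂ x)).unique (by
      simpa [ha] using hasSum_autocorrelation hu hC x)
  simp only [← hcx]
  refine ⟨c.continuous, ?_⟩
  have hcoef : ∀ m, fourierCoeff c m = a m := by
    intro m
    have h1 := hc.mapL (ContinuousMap.toLp (E := ℂ) 2 haarAddCircle ℂ)
    have h2 := h1.mapL (innerSL ℂ (fourierLp 2 m))
    rw [← fourierCoeff_toLp, ← fourierBasis_repr, fourierBasis.repr_apply_apply, coe_fourierBasis]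
    refine h2.unique ?_
    have h3 := hasSum_single (f := fun n : ℤ => if n = m then (a m : ℂ) else 0) m
      (by intro n hn; simp [hn])
    simp only [if_true] at h3
    refine (congrArg (fun g : ℤ → ℂ => HasSum g (a m : ℂ)) (funext fun n => ?_)).mpr h3
    have := (orthonormal_iff_ite.1 (orthonormal_fourier (T := L))) m n
    change inner ℂ (fourierLp 2 m) (ContinuousMap.toLp (E := ℂ) 2 haarAddCircle ℂ
      ((a n : ℂ) • fourier n)) = _
    rw [map_smul, inner_smul_right, this]
    by_cases h : n = m
    · simp [h]
    · simp [h, Ne.symm h]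
  have hP := hasSum_sq_fourierCoeff (ContinuousMap.toLp (E := ℂ) 2 haarAddCircle ℂ c)
  simp only [fourierCoeff_toLp, hcoef] at hP
  have e : ∫ t, ‖(ContinuousMap.toLp (E := ℂ) 2 haarAddCircle ℂ c) t‖ ^ 2 ∂haarAddCircle
      = ∫ t, ‖c t‖ ^ 2 ∂haarAddCircle := by
    refine integral_congr_ae ?_
    filter_upwards [ContinuousMap.coeFn_toLp (𝕜 := ℂ) (p := 2) haarAddCircle c] with t ht
    rw [ht]
  rw [e] at hP
  rw [← hP.tsum_eq]
  -- The coefficients of the autocorrelation are `a n = ‖fourierCoeff u n‖ ^ 2`. One factor `a n` is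
  -- bounded by `b ^ 2`; the other is summed by Parseval.
  have hterm : ∀ n, ‖(a n : ℂ)‖ ^ 2 ≤ b ^ 2 * a n := fun n => by
    have h0 : 0 ≤ a n := by positivity
    rw [Complex.norm_real, Real.norm_of_nonneg h0, sq]
    exact mul_le_mul_of_nonneg_right (pow_le_pow_left₀ (norm_nonneg _) (hb n) 2) h0
  calc ∑' n, ‖(a n : ℂ)‖ ^ 2 ≤ ∑' n, b ^ 2 * a n := hP.summable.tsum_le_tsum hterm (hs.mul_left _)
    _ = b ^ 2 * ∑' n, a n := tsum_mul_left
    _ ≤ b ^ 2 * C ^ 2 := by gcongr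

end Circle

section Circle

open MeasureTheory AddCircle

lemma integral_haarAddCircle_eq_interval {L : ℝ} [Fact (0 < L)] {E : Type*} [NormedAddCommGroup E]
    [NormedSpace ℝ E] (f : AddCircle L → E) :
    ∫ t, f t ∂haarAddCircle = L⁻¹ • ∫ t in (0 : ℝ)..L, f t := by
  rw [integral_haarAddCircle, ← AddCircle.intervalIntegral_preimage L 0 f, zero_add]

/-- If all Fourier transforms of `F` over `[0, T]` are small, then so is the mean square of its
autocorrelation over `[0, T]`. -/
lemma exists_autocorrelation_bound (F : ℝ →ᵇ ℂ) {T η : ℝ} (hT : 0 < T)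
    (h : ∀ μ, ‖average T (character μ * F) 0‖ ≤ η) :
    ∃ g : ℝ → ℝ, Continuous g ∧ (∀ x, 0 ≤ g x) ∧
      (∫ x in (0 : ℝ)..T, g x ≤ T * η ^ 2 * ‖F‖ ^ 2 / 2) ∧
      ∀ x ∈ Set.Ioc 0 T,
        g x = ‖∫ t in (0 : ℝ)..(T - x), F (t + x) * conj (F t)‖ ^ 2 / (4 * T ^ 2) := by
  have hL : Fact (0 < 2 * T) := ⟨by positivity⟩
  -- Padding with zeros up to length `2 * T` keeps the autocorrelation for shifts up to `T` free of
  -- wrap-around.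
  set v : ℝ → ℂ := {x | x ≤ T}.indicator F with hv
  have hvm : Measurable v := F.continuous.measurable.indicator measurableSet_Iic
  set u : AddCircle (2 * T) → ℂ := liftIoc (2 * T) 0 v with hu
  have hum : Measurable u :=
    hvm.comp (measurable_subtype_coe.comp (measurableEquivIoc (2 * T) 0).measurable)
  have hux : ∀ x ∈ Set.Ioc 0 (2 * T), u (x : AddCircle (2 * T)) = v x := fun x hx =>
    liftIoc_coe_apply (by simpa using hx)
  have hvC : ∀ t, ‖v t‖ ≤ ‖F‖ := fun t => by
    refine (norm_indicator_le_norm_self _ _).trans (F.norm_coe_le_norm t)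
  have huC : ∀ t, ‖u t‖ ≤ ‖F‖ := fun t => hvC _
  -- The factor `1 / 2` is the ratio of the window `T` to the circumference `2 * T`.
  have hcoef : ∀ n, ‖fourierCoeff u n‖ ≤ η / 2 := by
    intro n
    set μ : ℝ := -(Real.pi * n / T) with hμ
    have e : fourierCoeff u n = (1 / 2 : ℂ) * average T (character μ * F) 0 := by
      rw [fourierCoeff, integral_haarAddCircle_eq_interval]
      have e1 : ∫ t in (0 : ℝ)..(2 * T), (fourier (-n) (t : AddCircle (2 * T)) : ℂ) • u t
          = ∫ t in (0 : ℝ)..(2 * T), {x | x ≤ T}.indicator (fun t => character μ t * F t) t := by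
        refine intervalIntegral.integral_congr_ae (Eventually.of_forall fun t ht => ?_)
        rw [Set.uIoc_of_le (by positivity)] at ht
        rw [hux t ht, fourier_coe_apply, hv]
        by_cases htT : t ≤ T
        · rw [Set.indicator_of_mem (by exact htT), Set.indicator_of_mem (by exact htT),
            smul_eq_mul, character_apply, hμ]
          congr 2
          have : (T : ℂ) ≠ 0 := by exact_mod_cast hT.ne'
          push_cast; field_simp
        · rw [Set.indicator_of_notMem (by exact htT), Set.indicator_of_notMem (by exact htT),
            smul_zero]
      rw [e1, intervalIntegral.integral_indicator ⟨hT.le, by linarith⟩, average]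
      simp only [zero_add, BoundedContinuousFunction.mul_apply]
      rw [Complex.real_smul]; push_cast; ring
    rw [e, norm_mul]
    have := h μ
    norm_num
    linarith
  obtain ⟨hcont, hle⟩ := integral_norm_sq_autocorrelation_le hum huC hcoef
  set c : AddCircle (2 * T) → ℂ := fun x => ∫ t, conj (u t) * u (t + x) ∂haarAddCircle with hc
  have hg : Continuous fun x : ℝ => ‖c x‖ ^ 2 :=
    ((hcont.comp (AddCircle.continuous_mk' _)).norm.pow 2)
  refine ⟨fun x => ‖c x‖ ^ 2, hg, fun x => by positivity, ?_, ?_⟩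
  · rw [integral_haarAddCircle_eq_interval, smul_eq_mul, inv_mul_le_iff₀ hL.out] at hle
    have h1 : ∫ x in (0 : ℝ)..T, ‖c x‖ ^ 2 ≤ ∫ x in (0 : ℝ)..(2 * T), ‖c x‖ ^ 2 :=
      intervalIntegral.integral_mono_interval le_rfl hT.le (by linarith)
        (Eventually.of_forall fun x => by positivity) (hg.intervalIntegrable _ _)
    refine (h1.trans hle).trans (le_of_eq ?_)
    ring
  · intro x hx
    have e : c x = ((2 * T : ℝ) : ℂ)⁻¹ * ∫ t in (0 : ℝ)..(T - x), F (t + x) * conj (F t) := by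
      rw [hc]
      simp only
      rw [integral_haarAddCircle_eq_interval]
      have e1 : ∫ t in (0 : ℝ)..(2 * T), conj (u t) * u ((t : AddCircle (2 * T)) + (x : ℝ))
          = ∫ t in (0 : ℝ)..(2 * T),
            {y | y ≤ T - x}.indicator (fun t => F (t + x) * conj (F t)) t := by
        refine intervalIntegral.integral_congr_ae (Eventually.of_forall fun t ht => ?_)
        rw [Set.uIoc_of_le (by positivity)] at ht
        rw [hux t ht]
        have hx0 := hx.1
        have hxT := hx.2
        by_cases htT : t ≤ T
        · have hmem : t + x ∈ Set.Ioc 0 (2 * T) := ⟨by linarith [ht.1], by linarith⟩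
          rw [← AddCircle.coe_add, hux _ hmem, hv, Set.indicator_of_mem (by exact htT)]
          by_cases htx : t ≤ T - x
          · rw [Set.indicator_of_mem (by simp; linarith), Set.indicator_of_mem (by exact htx),
              mul_comm]
          · rw [Set.indicator_of_notMem (by simp; linarith), Set.indicator_of_notMem (by exact htx),
              mul_zero]
        · rw [hv, Set.indicator_of_notMem (by exact htT),
            Set.indicator_of_notMem (by simp; linarith), map_zero, zero_mul]
      rw [e1, intervalIntegral.integral_indicator ⟨by linarith [hx.2], by linarith [hx.1]⟩,
        Complex.real_smul, Complex.ofReal_inv]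
    simp only [e, norm_mul, norm_inv, Complex.norm_real, Real.norm_of_nonneg hL.out.le]
    field_simp
    ring

end Circle

/-! ### Autocorrelation of almost periodic functions and the uniqueness theorem. -/

lemma IsAP.of_norm_translate_sub_le {F G : ℝ →ᵇ ℂ} (hF : IsAP F) (C : ℝ)
    (h : ∀ a b, ‖translate a G - translate b G‖ ≤ C * ‖translate a F - translate b F‖) :
    IsAP G := by
  have hC : ∀ ε > 0, 0 < ε / (|C| + 1) := fun ε hε => by positivity
  have hlt : ∀ ε > 0, ∀ a b, ‖translate a F - translate b F‖ < ε / (|C| + 1) →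
      ‖translate a G - translate b G‖ < ε := fun ε hε a b hab => by
    rw [lt_div_iff₀ (by positivity)] at hab
    have := h a b
    have h2 : C * ‖translate a F - translate b F‖ ≤ |C| * ‖translate a F - translate b F‖ :=
      mul_le_mul_of_nonneg_right (le_abs_self C) (norm_nonneg _)
    have := norm_nonneg (translate a F - translate b F)
    nlinarith
  constructor
  · refine Metric.continuous_iff.2 fun b ε hε => ?_
    obtain ⟨δ, hδ, hc⟩ := Metric.continuous_iff.1 hF.1 b _ (hC ε hε)
    refine ⟨δ, hδ, fun a ha => ?_⟩
    rw [dist_eq_norm]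
    exact hlt ε hε a b (by rw [← dist_eq_norm]; exact hc a ha)
  · refine Metric.totallyBounded_iff.2 fun ε hε => ?_
    obtain ⟨s, hs⟩ := hF.exists_finset (hC ε hε)
    refine ⟨(fun b => translate b G) '' s, s.finite_toSet.image _, ?_⟩
    rintro _ ⟨a, rfl⟩
    obtain ⟨b, hb, hab⟩ := hs a
    refine Set.mem_iUnion₂.2 ⟨translate b G, ⟨b, hb, rfl⟩, ?_⟩
    rw [Metric.mem_ball, dist_eq_norm]
    exact hlt ε hε a b hab

lemma norm_bohrMean_translate_mul_star_sub_le (F : ℝ →ᵇ ℂ) (a b : ℝ) :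
    ‖bohrMean (translate a F * star F) - bohrMean (translate b F * star F)‖
      ≤ ‖F‖ * ‖translate a F - translate b F‖ := by
  rw [← map_sub, ← sub_mul]
  refine (norm_bohrMean_le _).trans ((norm_mul_le _ _).trans (le_of_eq ?_))
  rw [norm_star, mul_comm]

/-- The autocorrelation `x ↦ M (F (t + x) * conj (F t))` of an almost periodic function. -/
def autocorrelation (F : ℝ →ᵇ ℂ) (hF : IsAP F) : ℝ →ᵇ ℂ :=
  BoundedContinuousFunction.ofNormedAddCommGroup (fun x => bohrMean (translate x F * star F))
    (bohrMean.continuous.comp (hF.1.mul continuous_const)) (‖F‖ * ‖F‖) fun x =>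
      (norm_bohrMean_le _).trans ((norm_mul_le _ _).trans (by
        rw [norm_star]
        exact mul_le_mul_of_nonneg_right (norm_translate_le x F) (norm_nonneg _)))

lemma autocorrelation_apply {F : ℝ →ᵇ ℂ} (hF : IsAP F) (x : ℝ) :
    autocorrelation F hF x = bohrMean (translate x F * star F) := rfl

lemma isAP_autocorrelation {F : ℝ →ᵇ ℂ} (hF : IsAP F) : IsAP (autocorrelation F hF) := by
  refine hF.of_norm_translate_sub_le ‖F‖ fun a b => ?_
  refine (BoundedContinuousFunction.norm_le (by positivity)).2 fun x => ?_
  refine (norm_bohrMean_translate_mul_star_sub_le F (x + a) (x + b)).trans ?_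
  exact mul_le_mul_of_nonneg_left (norm_translate_sub_translate a b x F) (norm_nonneg _)

/-- Uniformity in `x` holds because, up to a small error, only finitely many translates of `F`
occur, and the mean value theorem applies to each. -/
lemma IsAP.eventually_norm_average_sub_autocorrelation_le {F : ℝ →ᵇ ℂ} (hF : IsAP F) {ε : ℝ}
    (hε : 0 < ε) : ∀ᶠ S in atTop, ∀ x,
      ‖average S (translate x F * star F) 0 - autocorrelation F hF x‖ ≤ ε := by
  obtain ⟨s, hs⟩ := hF.exists_finset (ε := ε / (3 * (‖F‖ + 1))) (by positivity)
  have hb : ∀ b ∈ s, ∀ᶠ S in atTop,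
      ‖average S (translate b F * star F) 0 - autocorrelation F hF b‖ ≤ ε / 3 := fun b _ => by
    have hAP : IsAP (translate b F * star F) := by
      have hbF : IsAP (translate b F) := hF.of_norm_translate_sub_le 1 fun c d => by
        rw [translate_translate, translate_translate, one_mul, add_comm c, add_comm d]
        exact norm_translate_sub_translate c d b F
      exact hbF.mul hF.conj
    filter_upwards [hAP.eventually_norm_average_sub_bohrMean_le (ε := ε / 3) (by positivity)]
      with S hS using hS 0
  filter_upwards [(Filter.eventually_all_finset s).2 hb, eventually_gt_atTop 0] with S hS hS0 x
  obtain ⟨b, hbs, hxb⟩ := hs x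
  have h1 := hS b hbs
  have hsmall : ‖F‖ * ‖translate x F - translate b F‖ ≤ ε / 3 := by
    rw [lt_div_iff₀ (by positivity)] at hxb
    have := norm_nonneg (translate x F - translate b F)
    nlinarith
  have h2 := (norm_bohrMean_translate_mul_star_sub_le F x b).trans hsmall
  have h3 := norm_average_le hS0 ((translate x F - translate b F) * star F) 0
  have h4 : ‖(translate x F - translate b F) * star F‖ ≤ ε / 3 :=
    (norm_mul_le _ _).trans (by rw [norm_star, mul_comm]; exact hsmall)
  rw [sub_mul, average_sub] at h3
  rw [← autocorrelation_apply hF, ← autocorrelation_apply hF] at h2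
  have e : average S (translate x F * star F) 0 - autocorrelation F hF x
      = (average S (translate x F * star F) 0 - average S (translate b F * star F) 0)
        + (average S (translate b F * star F) 0 - autocorrelation F hF b)
        - (autocorrelation F hF x - autocorrelation F hF b) := by ring
  rw [e]
  refine (norm_sub_le _ _).trans ?_
  have := norm_add_le
    (average S (translate x F * star F) 0 - average S (translate b F * star F) 0)
    (average S (translate b F * star F) 0 - autocorrelation F hF b)
  rw [sub_mul] at h4
  linarith

/-- **Uniqueness theorem**: an almost periodic function all of whose Fourier coefficients vanish is
zero. -/
theorem IsAP.eq_zero_of_forall_bohrMean_eq_zero {F : ℝ →ᵇ ℂ} (hF : IsAP F)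
    (h0 : ∀ μ, bohrMean (character μ * F) = 0) : F = 0 := by
  set γ := autocorrelation F hF with hγ
  have hγAP : IsAP γ := isAP_autocorrelation hF
  have hmean : bohrMean (γ * star γ) = 0 := by
    refine bohrMean_eq_of_tendsto (Metric.tendsto_nhds.2 fun ε hε => ?_)
    -- The constants come from averaging `‖γ‖ ^ 2 ≤ 2 * η ^ 2 + 32 * g` over `[0, S]`, where the
    -- integral of `g` is at most `S * η ^ 2 * ‖F‖ ^ 2`.
    obtain ⟨η, hη, hηε⟩ : ∃ η > 0, (2 + 32 * ‖F‖ ^ 2) * η ^ 2 < ε := by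
      refine ⟨Real.sqrt (ε / (2 * (2 + 32 * ‖F‖ ^ 2))), by positivity, ?_⟩
      rw [Real.sq_sqrt (by positivity)]
      field_simp
      norm_num
    have h2S : Tendsto (fun S : ℝ => 2 * S) atTop atTop := tendsto_id.const_mul_atTop (by norm_num)
    obtain ⟨S₀, hS₀⟩ := eventually_atTop.1
      (hF.eventually_norm_average_sub_autocorrelation_le hη)
    filter_upwards [h2S.eventually (hF.eventually_norm_average_character_mul_le h0 hη),
      eventually_ge_atTop S₀, eventually_gt_atTop 0] with S h1 hSS hS
    -- With window `2 * S` and shifts `x ≤ S`, the overlap has length `2 * S - x ≥ S`, long enough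
    -- for its average to approximate `γ x`.
    obtain ⟨g, hgc, hg0, hgle, hg⟩ := exists_autocorrelation_bound F
      (mul_pos two_pos hS) fun μ => h1 μ 0
    have hpt : ∀ x ∈ Set.Ioc 0 S, ‖(γ * star γ) (0 + x)‖ ≤ 2 * η ^ 2 + 32 * g x := by
      intro x hx
      have hR : S ≤ 2 * S - x := by linarith [hx.2]
      have hR0 : 0 < 2 * S - x := hS.trans_le hR
      set I := ∫ t in (0 : ℝ)..(2 * S - x), F (t + x) * conj (F t) with hI
      have h2 := hS₀ (2 * S - x) (hSS.trans hR) x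
      have e : average (2 * S - x) (translate x F * star F) 0
          = ((2 * S - x : ℝ) : ℂ)⁻¹ * I := by
        simp only [average, zero_add, hI, BoundedContinuousFunction.mul_apply, translate_apply,
          BoundedContinuousFunction.star_apply, RCLike.star_def]
      rw [e, norm_sub_rev] at h2
      have h3 := norm_sub_norm_le (γ x) (((2 * S - x : ℝ) : ℂ)⁻¹ * I)
      rw [norm_mul, norm_inv, Complex.norm_real, Real.norm_of_nonneg hR0.le] at h3
      have h4 : (2 * S - x)⁻¹ * ‖I‖ ≤ S⁻¹ * ‖I‖ := by gcongr
      have h5 : ‖γ x‖ ≤ η + S⁻¹ * ‖I‖ := by linarith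
      have h6 : g x = (S⁻¹ * ‖I‖) ^ 2 / 16 := by
        rw [hg x ⟨hx.1, by linarith [hx.2]⟩, ← hI]; field_simp; ring
      have h7 : ‖(γ * star γ) (0 + x)‖ = ‖γ x‖ ^ 2 := by
        rw [zero_add, BoundedContinuousFunction.mul_apply, BoundedContinuousFunction.star_apply,
          norm_mul, norm_star, sq]
      rw [h7, h6]
      have h8 := pow_le_pow_left₀ (norm_nonneg _) h5 2
      nlinarith [sq_nonneg (η - S⁻¹ * ‖I‖)]
    have hint : ∫ x in (0 : ℝ)..S, g x ≤ S * η ^ 2 * ‖F‖ ^ 2 := by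
      refine le_trans (intervalIntegral.integral_mono_interval le_rfl hS.le (by linarith)
        (Eventually.of_forall fun x => hg0 x) (hgc.intervalIntegrable _ _)) (hgle.trans (le_of_eq ?_))
      ring
    have hnorm : ‖∫ x in (0 : ℝ)..S, (γ * star γ) (0 + x)‖
        ≤ ∫ x in (0 : ℝ)..S, (2 * η ^ 2 + 32 * g x) :=
      intervalIntegral.norm_integral_le_of_norm_le hS.le
        (Eventually.of_forall fun x hx => hpt x hx)
        (Continuous.intervalIntegrable (by fun_prop) _ _)
    have hsum : ∫ x in (0 : ℝ)..S, (2 * η ^ 2 + 32 * g x)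
        = S * (2 * η ^ 2) + 32 * ∫ x in (0 : ℝ)..S, g x := by
      rw [intervalIntegral.integral_add (by simp)
        (Continuous.intervalIntegrable (by fun_prop) _ _), intervalIntegral.integral_const_mul]
      simp
      ring
    rw [dist_zero_right, average, norm_mul, norm_inv, Complex.norm_real,
      Real.norm_of_nonneg hS.le, inv_mul_lt_iff₀ hS]
    nlinarith
  have hγ0 : γ = 0 := hγAP.eq_zero_of_bohrMean_eq_zero hmean
  refine hF.eq_zero_of_bohrMean_eq_zero ?_
  -- The autocorrelation at `0` is the mean square of `F`.
  have := congrArg (fun G : ℝ →ᵇ ℂ => G 0) hγ0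
  simpa [hγ, autocorrelation_apply] using this

/-! ### Linear flows on the torus: Kronecker's theorem and Bohr's inequality. -/

section Torus

open MeasureTheory AddCircle UnitAddTorus

variable {d : Type*} [Fintype d]

/-- The normalised Haar measure of the torus. -/
def torusMeasure (d : Type*) [Fintype d] : Measure (UnitAddTorus d) :=
  Measure.pi fun _ => (haarAddCircle : Measure UnitAddCircle)

instance : IsProbabilityMeasure (torusMeasure d) := by unfold torusMeasure; infer_instance

instance : (torusMeasure d).IsOpenPosMeasure := by unfold torusMeasure; infer_instance

lemma integrable_torus (φ : C(UnitAddTorus d, ℂ)) : Integrable φ (torusMeasure d) :=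
  φ.continuous.integrable_of_hasCompactSupport (HasCompactSupport.of_compactSpace _)

lemma integral_mFourier (k : d → ℤ) [Decidable (k = 0)] :
    ∫ x, mFourier k x ∂torusMeasure d = if k = 0 then 1 else 0 := by
  have h1 : ∀ n : ℤ, n ≠ 0 → ∫ x : UnitAddCircle, fourier n x ∂haarAddCircle = (0 : ℂ) :=
    fun n hn => integral_eq_zero_of_add_right_eq_neg (μ := haarAddCircle)
      (fourier_add_half_inv_index hn one_pos)
  have e : ∫ x, mFourier k x ∂torusMeasure d
      = ∏ i, ∫ x : UnitAddCircle, fourier (k i) x ∂haarAddCircle :=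
    integral_fintype_prod_eq_prod (fun i (x : UnitAddCircle) => (fourier (k i) x : ℂ))
  rw [e]
  split_ifs with h
  · subst h; simp
  · obtain ⟨i, hi⟩ := Function.ne_iff.1 h
    exact Finset.prod_eq_zero (Finset.mem_univ i) (h1 _ hi)

/-- The linear flow with frequencies `μ` on the torus. -/
def torusFlow (μ : d → ℝ) : C(ℝ, UnitAddTorus d) where
  toFun t i := ((μ i * t / (2 * Real.pi) : ℝ) : UnitAddCircle)
  continuous_toFun := continuous_pi fun i =>
    (AddCircle.continuous_mk' 1).comp (by fun_prop : Continuous fun t => μ i * t / (2 * Real.pi))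

lemma fourier_angle (n : ℤ) (θ : ℝ) :
    (fourier n ((θ / (2 * Real.pi) : ℝ) : UnitAddCircle) : ℂ)
      = Complex.exp ((n * θ : ℝ) * Complex.I) := by
  rw [fourier_coe_apply]
  congr 1
  have : (Real.pi : ℂ) ≠ 0 := by exact_mod_cast Real.pi_ne_zero
  push_cast; field_simp

/-- The restriction of a continuous function on the torus to an orbit of the linear flow. -/
def pullback (μ : d → ℝ) : C(UnitAddTorus d, ℂ) →L[ℂ] (ℝ →ᵇ ℂ) :=
  LinearMap.mkContinuous
    { toFun := fun φ => (BoundedContinuousFunction.mkOfCompact φ).compContinuous (torusFlow μ)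
      map_add' := fun _ _ => rfl
      map_smul' := fun _ _ => rfl }
    1 fun φ => by
      rw [one_mul]
      exact (BoundedContinuousFunction.norm_le (norm_nonneg _)).2 fun t => φ.norm_coe_le_norm _

lemma pullback_apply {d : Type*} (μ : d → ℝ) (φ : C(UnitAddTorus d, ℂ)) (t : ℝ) :
    pullback μ φ t = φ (torusFlow μ t) := rfl

lemma pullback_mFourier (μ : d → ℝ) (k : d → ℤ) :
    pullback μ (mFourier k) = character (∑ i, k i * μ i) := by
  ext t
  rw [pullback_apply, character_apply]
  change ∏ i, (fourier (k i) ((μ i * t / (2 * Real.pi) : ℝ) : UnitAddCircle) : ℂ) = _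
  simp only [fourier_angle, ← Complex.exp_sum]
  congr 1
  rw [← Finset.sum_mul, ← Complex.ofReal_sum, Finset.sum_mul]
  simp only [mul_assoc]

/-- Both sides are continuous and linear in `φ`, and the monomials `mFourier k` span a dense
subspace. -/
lemma bohrMean_mul_pullback (μ : d → ℝ) (F : ℝ →ᵇ ℂ) (p : C(UnitAddTorus d, ℂ))
    (h : ∀ k : d → ℤ, bohrMean (F * character (∑ i, k i * μ i))
      = ∫ x, mFourier k x * p x ∂torusMeasure d) (φ : C(UnitAddTorus d, ℂ)) :
    bohrMean (F * pullback μ φ) = ∫ x, φ x * p x ∂torusMeasure d := by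
  let A : C(UnitAddTorus d, ℂ) →L[ℂ] ℂ :=
    (bohrMean.comp (ContinuousLinearMap.mul ℂ (ℝ →ᵇ ℂ) F)).comp (pullback μ)
  let B : C(UnitAddTorus d, ℂ) →L[ℂ] ℂ := LinearMap.mkContinuous
    { toFun := fun φ => ∫ x, φ x * p x ∂torusMeasure d
      map_add' := fun φ ψ => by
        simp only [ContinuousMap.add_apply, add_mul]
        exact integral_add (integrable_torus (φ * p)) (integrable_torus (ψ * p))
      map_smul' := fun c φ => by
        simp only [ContinuousMap.smul_apply, smul_eq_mul, mul_assoc, RingHom.id_apply]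
        exact integral_const_mul _ _ }
    ‖p‖ fun φ => by
      refine (norm_integral_le_of_norm_le_const (C := ‖p‖ * ‖φ‖)
        (Eventually.of_forall fun x => ?_)).trans (by simp)
      rw [norm_mul, mul_comm]
      exact mul_le_mul (p.norm_coe_le_norm x) (φ.norm_coe_le_norm x) (norm_nonneg _) (norm_nonneg _)
  have hAB : A = B := by
    refine ContinuousLinearMap.ext_on (s := Set.range mFourier) ?_ ?_
    · rw [Submodule.dense_iff_topologicalClosure_eq_top]
      exact span_mFourier_closure_eq_top
    · rintro _ ⟨k, rfl⟩
      change bohrMean (F * pullback μ (mFourier k)) = _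
      rw [pullback_mFourier, h k]; rfl
  exact congrArg (fun Φ : C(UnitAddTorus d, ℂ) →L[ℂ] ℂ => Φ φ) hAB

/-- Linear independence over `ℤ` of finitely many frequencies. -/
def IntIndependent (μ : d → ℝ) : Prop := ∀ k : d → ℤ, ∑ i, k i * μ i = 0 → k = 0

/-- Weyl equidistribution: by independence, every nontrivial monomial pulls back to a character of
nonzero frequency, so both means vanish. -/
lemma bohrMean_pullback {μ : d → ℝ} (hμ : IntIndependent μ) (φ : C(UnitAddTorus d, ℂ)) :
    bohrMean (pullback μ φ) = ∫ x, φ x ∂torusMeasure d := by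
  classical
  have := bohrMean_mul_pullback μ 1 1 (fun k => ?_) φ
  · simpa using this
  · simp only [ContinuousMap.one_apply, mul_one, one_mul]
    rw [integral_mFourier]
    split_ifs with hk
    · subst hk; simp [character_zero, bohrMean_one]
    · exact bohrMean_character fun h => hk (hμ k h)

lemma eq_zero_of_integral_torus_eq_zero {g : UnitAddTorus d → ℝ} (hg : Continuous g)
    (h0 : ∀ x, 0 ≤ g x) (h : ∫ x, g x ∂torusMeasure d = 0) (x : UnitAddTorus d) : g x = 0 := by
  have hi : Integrable g (torusMeasure d) :=
    hg.integrable_of_hasCompactSupport (HasCompactSupport.of_compactSpace _)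
  have h1 := (integral_eq_zero_iff_of_nonneg h0 hi).1 h
  exact congrFun ((hg.ae_eq_iff_eq (torusMeasure d) continuous_const).1 h1) x

/-- **Kronecker's approximation theorem**. -/
theorem exists_character_near {μ : d → ℝ} (hμ : IntIndependent μ) (θ : d → ℝ) {δ : ℝ}
    (hδ : 0 < δ) : ∃ t, ∀ i, ‖character (μ i) t - Complex.exp (θ i * Complex.I)‖ < δ := by
  by_contra! hno
  -- A bump around the target point. If the orbit missed the neighbourhood, `g` would vanish along
  -- it, so its integral and hence `g` would be zero, although `g` equals `δ` at the target.
  let g : UnitAddTorus d → ℝ := fun x =>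
    max 0 (δ - ∑ i, ‖(fourier 1 (x i) : ℂ) - Complex.exp (θ i * Complex.I)‖)
  have hg : Continuous g := by fun_prop
  let φ : C(UnitAddTorus d, ℂ) := ⟨fun x => (g x : ℂ), by fun_prop⟩
  have hpull : pullback μ φ = 0 := by
    ext t
    obtain ⟨i, hi⟩ := hno t
    have hch : ∀ i, (fourier 1 (torusFlow μ t i) : ℂ) = character (μ i) t := fun i => by
      change (fourier 1 ((μ i * t / (2 * Real.pi) : ℝ) : UnitAddCircle) : ℂ) = _
      rw [fourier_angle, character_apply, Int.cast_one, one_mul]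
    have hle : δ ≤ ∑ i, ‖(fourier 1 (torusFlow μ t i) : ℂ) - Complex.exp (θ i * Complex.I)‖ := by
      simp only [hch]
      exact hi.trans (Finset.single_le_sum
        (f := fun i => ‖character (μ i) t - Complex.exp (θ i * Complex.I)‖)
        (fun _ _ => norm_nonneg _) (Finset.mem_univ i))
    change ((max 0 (δ - _) : ℝ) : ℂ) = 0
    rw [max_eq_left (by linarith)]; simp
  have hint := bohrMean_pullback hμ φ
  rw [hpull, map_zero] at hint
  have hint' : ∫ x, g x ∂torusMeasure d = 0 := by
    have : ((∫ x, g x ∂torusMeasure d : ℝ) : ℂ) = 0 := by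
      rw [← integral_complex_ofReal]; exact hint.symm
    exact_mod_cast this
  have h0 := eq_zero_of_integral_torus_eq_zero hg (fun x => le_max_left _ _) hint'
    fun i => ((θ i / (2 * Real.pi) : ℝ) : UnitAddCircle)
  have hval : g (fun i => ((θ i / (2 * Real.pi) : ℝ) : UnitAddCircle)) = δ := by
    simp only [g, fourier_angle, Int.cast_one, one_mul, sub_self, norm_zero,
      Finset.sum_const_zero, sub_zero]
    exact max_eq_right hδ.le
  rw [hval] at h0
  exact hδ.ne' h0

lemma norm_bohrMean_le_re {H K : ℝ →ᵇ ℂ} (h : ∀ t, ‖H t‖ ≤ (K t).re) :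
    ‖bohrMean H‖ ≤ (bohrMean K).re := by
  obtain ⟨z, hz, hzH⟩ : ∃ z : ℂ, ‖z‖ = 1 ∧ z * bohrMean H = ‖bohrMean H‖ := by
    refine ⟨Complex.exp ((-(bohrMean H).arg : ℝ) * Complex.I), Complex.norm_exp_ofReal_mul_I _, ?_⟩
    conv_lhs => rw [← Complex.norm_mul_exp_arg_mul_I (bohrMean H)]
    rw [mul_left_comm, ← Complex.exp_add]
    simp
  have h1 : (0 : ℝ) ≤ (bohrMean (K - z • H)).re := le_re_bohrMean fun t => by
    have h2 : (z * H t).re ≤ ‖H t‖ := (Complex.re_le_norm _).trans (by rw [norm_mul, hz, one_mul])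
    have h3 : ((K - z • H) t).re = (K t).re - (z * H t).re := by simp
    rw [h3]; linarith [h t]
  rw [map_sub, map_smul, smul_eq_mul, hzH, Complex.sub_re, Complex.ofReal_re] at h1
  linarith

/-- Here `p` plays the role of a conditional expectation of `F`. Testing with `conj p * w`, where
`w` is the excess of `‖p‖` over `‖F‖`, gives `∫ ‖p‖ ^ 2 * w ≤ ‖F‖ * ∫ ‖p‖ * w`, which forces `w` to
vanish. -/
lemma norm_le_of_forall_bohrMean_mul_pullback {μ : d → ℝ} (hμ : IntIndependent μ) (F : ℝ →ᵇ ℂ)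
    (p : C(UnitAddTorus d, ℂ))
    (h : ∀ φ : C(UnitAddTorus d, ℂ),
      bohrMean (F * pullback μ φ) = ∫ x, φ x * p x ∂torusMeasure d) (x : UnitAddTorus d) :
    ‖p x‖ ≤ ‖F‖ := by
  let w : UnitAddTorus d → ℝ := fun x => max 0 (‖p x‖ - ‖F‖)
  have hw : Continuous w := by fun_prop
  have hw0 : ∀ x, 0 ≤ w x := fun x => le_max_left _ _
  let φ : C(UnitAddTorus d, ℂ) := ⟨fun x => conj (p x) * w x, by fun_prop⟩
  let ψ : C(UnitAddTorus d, ℂ) := ⟨fun x => ((‖F‖ * (‖p x‖ * w x) : ℝ) : ℂ), by fun_prop⟩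
  have h1 : ‖bohrMean (F * pullback μ φ)‖ ≤ (bohrMean (pullback μ ψ)).re := by
    refine norm_bohrMean_le_re fun t => ?_
    rw [BoundedContinuousFunction.mul_apply, pullback_apply, pullback_apply, norm_mul]
    change ‖F t‖ * ‖conj (p (torusFlow μ t)) * (w (torusFlow μ t) : ℂ)‖ ≤
      ((‖F‖ * (‖p (torusFlow μ t)‖ * w (torusFlow μ t)) : ℝ) : ℂ).re
    rw [Complex.ofReal_re, norm_mul, RCLike.norm_conj, Complex.norm_real,
      Real.norm_of_nonneg (hw0 _)]
    exact mul_le_mul_of_nonneg_right (F.norm_coe_le_norm t)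
      (mul_nonneg (norm_nonneg _) (hw0 _))
  have h2 : bohrMean (F * pullback μ φ)
      = ((∫ x, ‖p x‖ ^ 2 * w x ∂torusMeasure d : ℝ) : ℂ) := by
    rw [h φ, ← integral_complex_ofReal]
    congr 1; ext x
    change conj (p x) * (w x : ℂ) * p x = _
    have : conj (p x) * p x = ((‖p x‖ ^ 2 : ℝ) : ℂ) := by
      rw [mul_comm, Complex.mul_conj, Complex.normSq_eq_norm_sq]
    rw [Complex.ofReal_mul, ← this]; ring
  have h3 : bohrMean (pullback μ ψ)
      = ((∫ x, ‖F‖ * (‖p x‖ * w x) ∂torusMeasure d : ℝ) : ℂ) := by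
    rw [bohrMean_pullback hμ, ← integral_complex_ofReal]; rfl
  rw [h2, h3, Complex.ofReal_re, Complex.norm_real] at h1
  have hint : ∀ {g : UnitAddTorus d → ℝ}, Continuous g → Integrable g (torusMeasure d) := fun hg =>
    hg.integrable_of_hasCompactSupport (HasCompactSupport.of_compactSpace _)
  let g : UnitAddTorus d → ℝ := fun x => ‖p x‖ ^ 2 * w x - ‖F‖ * (‖p x‖ * w x)
  have hgw : ∀ x, g x = ‖p x‖ * ((‖p x‖ - ‖F‖) * w x) := fun x => by simp only [g]; ring
  have hpos : ∀ x, 0 ≤ (‖p x‖ - ‖F‖) * w x := fun x => by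
    rcases le_total (‖p x‖ - ‖F‖) 0 with hx | hx
    · simp [w, max_eq_left hx]
    · exact mul_nonneg hx (hw0 x)
  have hg0 : ∀ x, 0 ≤ g x := fun x => by
    rw [hgw]; exact mul_nonneg (norm_nonneg _) (hpos x)
  have hgi : ∫ x, g x ∂torusMeasure d = 0 := by
    refine le_antisymm ?_ (integral_nonneg hg0)
    rw [integral_sub (hint (by fun_prop)) (hint (by fun_prop))]
    have := le_abs_self (∫ x, ‖p x‖ ^ 2 * w x ∂torusMeasure d)
    rw [Real.norm_eq_abs] at h1
    linarith
  have hgx := eq_zero_of_integral_torus_eq_zero (by fun_prop) hg0 hgi x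
  by_contra! hlt
  have hF : 0 < ‖p x‖ := lt_of_le_of_lt (norm_nonneg _) hlt
  have hwx : 0 < w x := lt_max_of_lt_right (sub_pos.2 hlt)
  rw [hgw] at hgx
  have : 0 < ‖p x‖ * ((‖p x‖ - ‖F‖) * w x) :=
    mul_pos hF (mul_pos (sub_pos.2 hlt) hwx)
  linarith

/-- If the only nonzero Fourier coefficients of `F` at integral combinations of the independent
frequencies `μ` are those at the `μ i` themselves, then the sum of their norms is at most the
supremum norm of `F`. -/
theorem sum_norm_bohrMean_le {μ : d → ℝ} (hμ : IntIndependent μ) (F : ℝ →ᵇ ℂ)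
    (h : ∀ k : d → ℤ, bohrMean (character (-∑ i, k i * μ i) * F) ≠ 0 →
      ∃ i, ∑ j, k j * μ j = μ i) :
    ∑ i, ‖bohrMean (character (-μ i) * F)‖ ≤ ‖F‖ := by
  classical
  set c : d → ℂ := fun i => bohrMean (character (-μ i) * F) with hc
  let p : C(UnitAddTorus d, ℂ) := ∑ i, c i • mFourier (Pi.single i 1)
  have hp : ∀ x, p x = ∑ i, c i * fourier 1 (x i) := fun x => by
    simp only [p, ContinuousMap.sum_apply, ContinuousMap.smul_apply, mFourier_single, smul_eq_mul]
  have hsingle : ∀ i, ∑ j, ((Pi.single i 1 : d → ℤ) j : ℝ) * μ j = μ i := fun i => by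
    rw [Finset.sum_eq_single i] <;> simp +contextual
  -- Multiplication by a character picks the coefficient at the opposite frequency, so both sides
  -- can be nonzero only when `k` is minus a unit vector.
  have hkey : ∀ k : d → ℤ, bohrMean (F * character (∑ i, k i * μ i))
      = ∫ x, mFourier k x * p x ∂torusMeasure d := by
    intro k
    have e1 : ∫ x, mFourier k x * p x ∂torusMeasure d
        = ∑ i, c i * if k + Pi.single i 1 = 0 then 1 else 0 := by
      simp only [← integral_mFourier, ← integral_const_mul]
      have hs := integral_finsetSum (μ := torusMeasure d)
        (f := fun i x => c i * mFourier (k + Pi.single i 1) x) Finset.univ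
        fun i _ => (integrable_torus (mFourier (k + Pi.single i 1))).const_mul (c i)
      rw [← hs]
      congr 1; ext x
      simp only [p, ContinuousMap.sum_apply, ContinuousMap.smul_apply, smul_eq_mul, mFourier_add,
        Finset.mul_sum]
      exact Finset.sum_congr rfl fun i _ => by ring
    rw [e1]
    have e2 : bohrMean (F * character (∑ i, k i * μ i))
        = bohrMean (character (-∑ i, ((-k) i : ℤ) * μ i) * F) := by
      rw [mul_comm]; congr 3; simp
    rw [e2]
    by_cases hk : ∃ i, k + Pi.single i 1 = 0
    · obtain ⟨i, hi⟩ := hk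
      have hki : -k = Pi.single i 1 := by rw [neg_eq_iff_add_eq_zero, hi]
      rw [hki, hsingle, Finset.sum_eq_single i]
      · simp [hi, hc]
      · intro j _ hj
        rw [if_neg, mul_zero]
        intro h2
        have h3 : (Pi.single i 1 : d → ℤ) = Pi.single j 1 :=
          add_left_cancel (hi.trans h2.symm)
        have h4 := congrFun h3 j
        simp [hj] at h4
      · simp
    · push Not at hk
      have h3 : ∑ i, (c i * if k + Pi.single i 1 = 0 then 1 else 0) = 0 :=
        Finset.sum_eq_zero fun i _ => by rw [if_neg (hk i), mul_zero]
      rw [h3]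
      by_contra hne
      obtain ⟨i, hi⟩ := h (-k) hne
      refine hk i ?_
      have h4 : k + Pi.single i 1 = 0 := by
        refine hμ _ ?_
        simp only [Pi.add_apply, Int.cast_add, add_mul, Finset.sum_add_distrib, hsingle]
        rw [← hi]; simp
      exact h4
  -- At this point of the torus the phases of all `c i` cancel, so `p` equals the sum of the norms.
  have hbound := norm_le_of_forall_bohrMean_mul_pullback hμ F p (bohrMean_mul_pullback μ F p hkey)
    fun i => ((-(c i).arg / (2 * Real.pi) : ℝ) : UnitAddCircle)
  have hval : ∀ i, c i * fourier 1 ((-(c i).arg / (2 * Real.pi) : ℝ) : UnitAddCircle)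
      = (‖c i‖ : ℂ) := fun i => by
    rw [fourier_angle]
    conv_lhs => rw [← Complex.norm_mul_exp_arg_mul_I (c i)]
    rw [mul_assoc, ← Complex.exp_add]
    simp
  rw [hp] at hbound
  simp only [hval] at hbound
  rw [← Complex.ofReal_sum, Complex.norm_real,
    Real.norm_of_nonneg (Finset.sum_nonneg fun _ _ => norm_nonneg _)] at hbound
  exact hbound

end Torus

/-! ### Fourier series with linearly independent frequencies. -/

/-- The Fourier coefficient of a bounded function at the frequency `μ`. -/
def coeff (μ : ℝ) : (ℝ →ᵇ ℂ) →L[ℂ] ℂ :=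
  bohrMean.comp (ContinuousLinearMap.mul ℂ (ℝ →ᵇ ℂ) (character (-μ)))

lemma coeff_apply (μ : ℝ) (F : ℝ →ᵇ ℂ) : coeff μ F = bohrMean (character (-μ) * F) := rfl

lemma coeff_character (μ ν : ℝ) [Decidable (μ = ν)] :
    coeff μ (character ν) = if μ = ν then 1 else 0 := by
  rw [coeff_apply, character_mul]
  split_ifs with h
  · rw [h, neg_add_cancel, character_zero, bohrMean_one]
  · exact bohrMean_character fun h2 => h (by linarith)

lemma intIndependent_of_subset {Λ : Set ℝ} (hΛ : LinearIndepOn ℚ id Λ) (s : Finset ℝ)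
    (hs : ↑s ⊆ Λ) : IntIndependent fun i : s => (i : ℝ) := by
  intro k hk
  have h1 := linearIndepOn_finset_iff.1 (hΛ.mono hs)
    (fun x => if h : x ∈ s then (k ⟨x, h⟩ : ℚ) else 0) (by
      rw [← Finset.sum_coe_sort s, ← hk]
      refine Finset.sum_congr rfl fun i _ => ?_
      simp [Rat.smul_def])
  funext i
  have := h1 i i.2
  simpa using this

/-- Otherwise the sum `ν` would be an element of `Λ` outside `s`, and its expression through `s` a
rational relation with coefficient `-1` at `ν`. This supplies the hypothesis of
`sum_norm_bohrMean_le`. -/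
lemma mem_of_sum_mem {Λ : Set ℝ} (hΛ : LinearIndepOn ℚ id Λ) (s : Finset ℝ) (hs : ↑s ⊆ Λ)
    (k : s → ℤ) (hk : ∑ i, k i * (i : ℝ) ∈ Λ) : ∑ i, k i * (i : ℝ) ∈ s := by
  set ν := ∑ i, k i * (i : ℝ) with hν
  by_contra hνs
  have hsub : ↑(insert ν s) ⊆ Λ := by
    rw [Finset.coe_insert]; exact Set.insert_subset hk hs
  have h1 := linearIndepOn_finset_iff.1 (hΛ.mono hsub)
    (fun x => if h : x ∈ s then (k ⟨x, h⟩ : ℚ) else -1) (by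
      rw [Finset.sum_insert hνs, ← Finset.sum_coe_sort s]
      have e : ∑ i : s, (if h : (i : ℝ) ∈ s then (k ⟨i, h⟩ : ℚ) else -1) • id (i : ℝ) = ν := by
        rw [hν]
        refine Finset.sum_congr rfl fun i _ => ?_
        simp [Rat.smul_def]
      rw [e]
      simp [hνs])
  have := h1 ν (Finset.mem_insert_self _ _)
  simp [hνs] at this

/-- **Bohr's theorem**: the Fourier coefficients of an almost periodic function with linearly
independent frequencies are absolutely summable. -/
theorem summable_norm_coeff {F : ℝ →ᵇ ℂ}
    (hΛ : LinearIndepOn ℚ id {μ : ℝ | coeff μ F ≠ 0}) : Summable fun μ => ‖coeff μ F‖ := by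
  classical
  refine summable_of_sum_le (c := ‖F‖) (fun _ => norm_nonneg _) fun u => ?_
  set s := u.filter fun μ => coeff μ F ≠ 0 with hs
  have hsub : (s : Set ℝ) ⊆ {μ : ℝ | coeff μ F ≠ 0} := fun x hx => by
    simpa using (Finset.mem_filter.1 hx).2
  have e : ∑ μ ∈ u, ‖coeff μ F‖ = ∑ μ ∈ s, ‖coeff μ F‖ := by
    rw [hs, Finset.sum_filter_of_ne]
    intro x _ hx
    simpa using hx
  rw [e, ← Finset.sum_coe_sort s]
  refine sum_norm_bohrMean_le (intIndependent_of_subset hΛ s hsub) F fun k hk => ?_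
  exact ⟨⟨_, mem_of_sum_mem hΛ s hsub k hk⟩, rfl⟩

/-- An almost periodic function with linearly independent frequencies is the sum of its Fourier
series. -/
theorem IsAP.hasSum_coeff_smul_character {F : ℝ →ᵇ ℂ} (hF : IsAP F)
    (hΛ : LinearIndepOn ℚ id {μ : ℝ | coeff μ F ≠ 0}) :
    HasSum (fun μ => coeff μ F • character μ) F := by
  classical
  have hsum : Summable fun μ => coeff μ F • character μ := by
    refine Summable.of_norm_bounded (summable_norm_coeff hΛ) fun μ => ?_
    rw [norm_smul]
    exact mul_le_of_le_one_right (norm_nonneg _) (norm_character_le μ)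
  obtain ⟨S, hS⟩ := hsum
  have hcoeff : ∀ ν, coeff ν S = coeff ν F := fun ν => by
    refine (hS.mapL (coeff ν)).unique ?_
    have h1 := hasSum_single (f := fun μ => coeff ν (coeff μ F • character μ)) ν fun μ hμ => by
      rw [map_smul, coeff_character, if_neg (Ne.symm hμ), smul_zero]
    simpa [coeff_character] using h1
  have hSAP : IsAP S := IsAP.of_forall_exists fun ε hε => by
    obtain ⟨s, hs⟩ := (Metric.tendsto_nhds.1 hS ε hε).exists
    refine ⟨_, IsAP.sum s fun μ _ => (isAP_character μ).smul (coeff μ F), ?_⟩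
    rw [← dist_eq_norm, dist_comm]; exact hs
  -- The series converges in norm to some almost periodic `S` with the coefficients of `F`;
  -- uniqueness identifies the two.
  have hzero : F - S = 0 := (hF.sub hSAP).eq_zero_of_forall_bohrMean_eq_zero fun μ => by
    have : coeff (-μ) (F - S) = 0 := by rw [map_sub, hcoeff, sub_self]
    rwa [coeff_apply, neg_neg] at this
  rwa [← sub_eq_zero.1 hzero] at hS

/-! ### From Bohr's definition to Bochner's. -/

/-- Functions that are almost periodic in the sense of Bohr are almost periodic in the sense of
Bochner. -/
lemma IsAP.of_relatively_dense {F : ℝ →ᵇ ℂ}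
    (h : ∀ ε > 0, ∃ l > 0, ∀ t₀ : ℝ, ∃ τ ∈ Set.Ioo t₀ (t₀ + l), ∀ t, ‖F (t + τ) - F t‖ ≤ ε) :
    IsAP F := by
  have hcont : ∀ ε > 0, ∃ δ > 0, ∀ a, |a| < δ → ∀ t, ‖F (t + a) - F t‖ < ε := by
    intro ε hε
    obtain ⟨l, hl, hτ⟩ := h (ε / 4) (by positivity)
    have huc := (isCompact_Icc (a := (-1 : ℝ)) (b := l + 1)).uniformContinuousOn_of_continuous
      F.continuous.continuousOn
    obtain ⟨δ, hδ, hd⟩ := Metric.uniformContinuousOn_iff.1 huc (ε / 4) (by positivity)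
    refine ⟨min δ 1, by positivity, fun a ha t => ?_⟩
    -- This `τ` carries `t` into `(0, l)`; the margin `1` on each side of the compact interval
    -- leaves room for the shift `a`.
    obtain ⟨τ, hτ1, hτ2⟩ := hτ (-t)
    have ha1 := abs_lt.1 (lt_of_lt_of_le ha (min_le_right _ _))
    have h1 := hτ2 t
    have h2 := hτ2 (t + a)
    have h3 := hd (t + a + τ) ⟨by linarith [hτ1.1], by linarith [hτ1.2]⟩ (t + τ)
      ⟨by linarith [hτ1.1], by linarith [hτ1.2]⟩ (by
        rw [Real.dist_eq]
        have : t + a + τ - (t + τ) = a := by ring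
        rw [this]; exact lt_of_lt_of_le ha (min_le_left _ _))
    rw [dist_eq_norm] at h3
    have e : F (t + a) - F t = -(F (t + a + τ) - F (t + a)) + (F (t + a + τ) - F (t + τ))
        + (F (t + τ) - F t) := by ring
    rw [e]
    have h4 := norm_add_le (-(F (t + a + τ) - F (t + a)) + (F (t + a + τ) - F (t + τ)))
      (F (t + τ) - F t)
    have h5 := norm_add_le (-(F (t + a + τ) - F (t + a))) (F (t + a + τ) - F (t + τ))
    rw [norm_neg] at h5
    linarith
  have horbit : Continuous fun a => translate a F := by
    refine Metric.continuous_iff.2 fun b ε hε => ?_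
    obtain ⟨δ, hδ, hd⟩ := hcont (ε / 2) (by positivity)
    refine ⟨δ, hδ, fun a ha => ?_⟩
    rw [Real.dist_eq] at ha
    rw [dist_eq_norm]
    refine lt_of_le_of_lt ((BoundedContinuousFunction.norm_le (by positivity)).2 fun t => ?_)
      (half_lt_self hε)
    have := hd (a - b) ha (t + b)
    have e : t + b + (a - b) = t + a := by ring
    rw [e] at this
    exact this.le
  refine ⟨horbit, Metric.totallyBounded_iff.2 fun ε hε => ?_⟩
  obtain ⟨l, hl, hτ⟩ := h (ε / 2) (by positivity)
  obtain ⟨t, htf, ht⟩ := Metric.totallyBounded_iff.1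
    ((isCompact_Icc (a := (0 : ℝ)) (b := l)).image horbit).totallyBounded (ε / 2) (by positivity)
  refine ⟨t, htf, ?_⟩
  rintro _ ⟨a, rfl⟩
  obtain ⟨τ, hτ1, hτ2⟩ := hτ (-a)
  obtain ⟨G, hG, hd⟩ := Set.mem_iUnion₂.1
    (ht ⟨a + τ, ⟨by linarith [hτ1.1], by linarith [hτ1.2]⟩, rfl⟩)
  refine Set.mem_iUnion₂.2 ⟨G, hG, ?_⟩
  have h1 : dist (translate (a + τ) F) (translate a F) ≤ ε / 2 := by
    rw [dist_eq_norm]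
    refine (BoundedContinuousFunction.norm_le (by positivity)).2 fun x => ?_
    have := hτ2 (x + a)
    rwa [add_assoc] at this
  rw [Metric.mem_ball] at hd ⊢
  have := dist_triangle_left (translate a F) G (translate (a + τ) F)
  linarith

/-! ### Entire almost periodic functions and their Dirichlet series. -/

section Entire

variable {f : ℂ → ℂ}

lemma mem_realInterval_bot_top (σ : ℝ) : σ ∈ realInterval ⊥ ⊤ :=
  ⟨EReal.bot_lt_coe σ, EReal.coe_lt_top σ⟩

lemma differentiable_of_isAlmostPeriodicInStrip (hf : IsAlmostPeriodicInStrip ⊥ ⊤ f) :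
    Differentiable ℂ f := by
  have h : verticalStrip ⊥ ⊤ = Set.univ :=
    Set.eq_univ_of_forall fun s => mem_realInterval_bot_top s.re
  have h1 := hf.1
  rw [h] at h1
  exact differentiableOn_univ.1 h1

lemma exists_bound_on_strip (hf : IsAlmostPeriodicInStrip ⊥ ⊤ f) {a b : ℝ} (hab : a ≤ b) :
    ∃ B, ∀ s : ℂ, s.re ∈ Set.Icc a b → ‖f s‖ ≤ B := by
  have hd := differentiable_of_isAlmostPeriodicInStrip hf
  obtain ⟨l, hl, h⟩ := hf.2 a (mem_realInterval_bot_top a) b (mem_realInterval_bot_top b) hab 1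
    one_pos
  have hK : IsCompact (Set.Icc a b ×ℂ Set.Icc 0 l) := isCompact_Icc.reProdIm isCompact_Icc
  obtain ⟨B, hB⟩ := hK.exists_bound_of_continuousOn hd.continuous.continuousOn
  refine ⟨B + 1, fun s hs => ?_⟩
  obtain ⟨τ, hτ1, hτ2⟩ := h (-s.im)
  have h1 := hτ2 s hs
  have h2 := hB (s + Complex.I * τ) (by
    rw [Complex.mem_reProdIm]
    have hr : (s + Complex.I * τ).re = s.re := by simp
    have hi : (s + Complex.I * τ).im = s.im + τ := by simp
    rw [hr, hi]
    exact ⟨hs, by linarith [hτ1.1], by linarith [hτ1.2]⟩)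
  have h3 := norm_sub_norm_le (f s) (f (s + Complex.I * τ))
  rw [norm_sub_rev] at h3
  linarith

/-- The restriction of an almost periodic function to the line `Re s = σ`. -/
def lineFunction (hf : IsAlmostPeriodicInStrip ⊥ ⊤ f) (σ : ℝ) : ℝ →ᵇ ℂ :=
  BoundedContinuousFunction.ofNormedAddCommGroup (fun t : ℝ => f (σ + Complex.I * t))
    ((differentiable_of_isAlmostPeriodicInStrip hf).continuous.comp (by fun_prop))
    (exists_bound_on_strip hf (le_refl σ)).choose fun t =>
      (exists_bound_on_strip hf (le_refl σ)).choose_spec _ (by simp)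

lemma lineFunction_apply (hf : IsAlmostPeriodicInStrip ⊥ ⊤ f) (σ t : ℝ) :
    lineFunction hf σ t = f (σ + Complex.I * t) := rfl

lemma isAP_lineFunction (hf : IsAlmostPeriodicInStrip ⊥ ⊤ f) (σ : ℝ) :
    IsAP (lineFunction hf σ) := by
  refine IsAP.of_relatively_dense fun ε hε => ?_
  obtain ⟨l, hl, h⟩ := hf.2 σ (mem_realInterval_bot_top σ) σ (mem_realInterval_bot_top σ) le_rfl
    ε hε
  refine ⟨l, hl, fun t₀ => ?_⟩
  obtain ⟨τ, hτ1, hτ2⟩ := h t₀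
  refine ⟨τ, hτ1, fun t => ?_⟩
  have := hτ2 (σ + Complex.I * t) (by simp)
  rw [lineFunction_apply, lineFunction_apply]
  convert this using 4
  push_cast; ring

/-- The Dirichlet coefficient computed on the line `Re s = σ`. -/
def lineCoeff (hf : IsAlmostPeriodicInStrip ⊥ ⊤ f) (μ σ : ℝ) : ℂ :=
  Complex.exp (-(μ * σ : ℝ)) * coeff μ (lineFunction hf σ)

lemma coeff_lineFunction (hf : IsAlmostPeriodicInStrip ⊥ ⊤ f) (μ σ : ℝ) :
    coeff μ (lineFunction hf σ) = lineCoeff hf μ σ * Complex.exp (μ * σ : ℝ) := by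
  rw [lineCoeff, mul_right_comm, ← Complex.exp_add]; simp

lemma tendsto_lineCoeff (hf : IsAlmostPeriodicInStrip ⊥ ⊤ f) (μ σ : ℝ) :
    Tendsto (fun T : ℝ => ((1 / (2 * T) : ℝ) : ℂ) *
      ∫ t in (-T)..T, f ((σ : ℂ) + Complex.I * (t : ℂ)) *
        Complex.exp (-((μ : ℂ) * ((σ : ℂ) + Complex.I * (t : ℂ))))) atTop
      (𝓝 (lineCoeff hf μ σ)) := by
  have h := (((isAP_character (-μ)).mul (isAP_lineFunction hf σ)).tendsto_symmetric_average).const_mul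
    (Complex.exp (-(μ * σ : ℝ)))
  refine h.congr fun T => ?_
  rw [mul_left_comm, ← intervalIntegral.integral_const_mul]
  congr 2; ext t
  rw [BoundedContinuousFunction.mul_apply, lineFunction_apply, character_apply, ← mul_assoc,
    ← Complex.exp_add, mul_comm]
  congr 2
  push_cast; ring

/-- Cauchy's theorem on a rectangle: the difference is carried by the two horizontal sides, whose
length does not depend on `T`. -/
lemma norm_integral_line_sub_le {g : ℂ → ℂ} (hg : Differentiable ℂ g) {a b B : ℝ} (hab : a ≤ b)
    (hB : ∀ s : ℂ, s.re ∈ Set.Icc a b → ‖g s‖ ≤ B) (T : ℝ) :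
    ‖(∫ t in (-T)..T, g (b + Complex.I * t)) - ∫ t in (-T)..T, g (a + Complex.I * t)‖
      ≤ 2 * (B * (b - a)) := by
  have h := Complex.integral_boundary_rect_eq_zero_of_differentiableOn g
    (a + (-T : ℝ) * Complex.I) (b + (T : ℝ) * Complex.I) hg.differentiableOn
  have hre : ∀ x y : ℝ, ((x : ℂ) + (y : ℂ) * Complex.I).re = x := fun x y => by simp
  have him : ∀ x y : ℝ, ((x : ℂ) + (y : ℂ) * Complex.I).im = y := fun x y => by simp
  simp only [hre, him, smul_eq_mul] at h
  have hbd : ∀ y : ℝ, ‖∫ x in a..b, g (x + y * Complex.I)‖ ≤ B * (b - a) := fun y => by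
    have h1 : ‖∫ x in a..b, g (x + y * Complex.I)‖ ≤ B * |b - a| := by
      refine intervalIntegral.norm_integral_le_of_norm_le_const fun x hx => hB _ ?_
      rw [Set.uIoc_of_le hab] at hx
      rw [hre]; exact Set.Ioc_subset_Icc_self hx
    rwa [abs_of_nonneg (by linarith)] at h1
  simp only [mul_comm Complex.I]
  have e : Complex.I * ((∫ t in (-T)..T, g (b + t * Complex.I)) - ∫ t in (-T)..T,
      g (a + t * Complex.I)) = (∫ x in a..b, g (x + (T : ℝ) * Complex.I))
        - ∫ x in a..b, g (x + (-T : ℝ) * Complex.I) := by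
    linear_combination h
  have h2 := (norm_sub_le (∫ x in a..b, g (x + (T : ℝ) * Complex.I))
    (∫ x in a..b, g (x + (-T : ℝ) * Complex.I))).trans (add_le_add (hbd T) (hbd (-T)))
  rw [← e, norm_mul, Complex.norm_I, one_mul] at h2
  linarith

/-- The integrals over the two lines differ by a bounded amount, which the factor `1 / (2 * T)`
sends to zero. -/
lemma lineCoeff_eq (hf : IsAlmostPeriodicInStrip ⊥ ⊤ f) (μ a b : ℝ) :
    lineCoeff hf μ a = lineCoeff hf μ b := by
  wlog hab : a ≤ b generalizing a b
  · exact (this b a (le_of_not_ge hab)).symm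
  obtain ⟨B, hB⟩ := exists_bound_on_strip hf hab
  set g : ℂ → ℂ := fun s => f s * Complex.exp (-((μ : ℂ) * s)) with hg
  have hgd : Differentiable ℂ g :=
    (differentiable_of_isAlmostPeriodicInStrip hf).mul (by fun_prop)
  have hgB : ∀ s : ℂ, s.re ∈ Set.Icc a b →
      ‖g s‖ ≤ B * Real.exp (|μ| * (|a| + |b|)) := fun s hs => by
    rw [hg, norm_mul, Complex.norm_exp]
    have h1 := hB s hs
    have h2 : (-((μ : ℂ) * s)).re ≤ |μ| * (|a| + |b|) := by
      have hre : (-((μ : ℂ) * s)).re = -(μ * s.re) := by simp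
      have hs' : |s.re| ≤ |a| + |b| := by
        rw [abs_le]
        have := neg_abs_le a
        have := le_abs_self b
        have := abs_nonneg a
        have := abs_nonneg b
        exact ⟨by linarith [hs.1], by linarith [hs.2]⟩
      rw [hre]
      refine (neg_le_abs _).trans ?_
      rw [abs_mul]
      exact mul_le_mul_of_nonneg_left hs' (abs_nonneg _)
    exact mul_le_mul h1 (Real.exp_le_exp.2 h2) (Real.exp_pos _).le ((norm_nonneg _).trans h1)
  have hlim := (tendsto_lineCoeff hf μ b).sub (tendsto_lineCoeff hf μ a)
  have h0 : Tendsto (fun T : ℝ => ((1 / (2 * T) : ℝ) : ℂ) *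
      (∫ t in (-T)..T, g (b + Complex.I * t)) - ((1 / (2 * T) : ℝ) : ℂ) *
      ∫ t in (-T)..T, g (a + Complex.I * t)) atTop (𝓝 0) := by
    refine squeeze_zero_norm'
      (a := fun T : ℝ => (B * Real.exp (|μ| * (|a| + |b|)) * (b - a)) / T)
      ((eventually_gt_atTop 0).mono fun T hT => ?_) (tendsto_const_nhds.div_atTop tendsto_id)
    have := norm_integral_line_sub_le hgd hab hgB T
    rw [← mul_sub, norm_mul, Complex.norm_real, Real.norm_of_nonneg (by positivity),
      one_div, inv_mul_le_iff₀ (by positivity)]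
    refine this.trans (le_of_eq ?_)
    field_simp
  have := tendsto_nhds_unique hlim h0
  exact (sub_eq_zero.1 this).symm

lemma isDirichletCoeff_iff (hf : IsAlmostPeriodicInStrip ⊥ ⊤ f) (μ : ℝ) (c : ℂ) :
    IsDirichletCoeff ⊥ ⊤ f μ c ↔ c = lineCoeff hf μ 0 := by
  constructor
  · intro h
    exact tendsto_nhds_unique (h 0 (mem_realInterval_bot_top 0)) (tendsto_lineCoeff hf μ 0)
  · rintro rfl σ -
    rw [lineCoeff_eq hf μ 0 σ]
    exact tendsto_lineCoeff hf μ σ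

lemma mem_fourierExponents_iff (hf : IsAlmostPeriodicInStrip ⊥ ⊤ f) (μ : ℝ) :
    μ ∈ fourierExponents ⊥ ⊤ f ↔ lineCoeff hf μ 0 ≠ 0 := by
  simp only [fourierExponents, Set.mem_ofPred_eq, isDirichletCoeff_iff hf]
  constructor
  · rintro ⟨c, hc, rfl⟩; exact hc
  · exact fun h => ⟨_, h, rfl⟩

lemma coeff_lineFunction_ne_zero_iff (hf : IsAlmostPeriodicInStrip ⊥ ⊤ f) (μ σ : ℝ) :
    coeff μ (lineFunction hf σ) ≠ 0 ↔ μ ∈ fourierExponents ⊥ ⊤ f := by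
  rw [mem_fourierExponents_iff hf, coeff_lineFunction, lineCoeff_eq hf μ σ 0]
  simp

lemma summable_norm_lineCoeff (hf : IsAlmostPeriodicInStrip ⊥ ⊤ f)
    (hΛ : LinearIndepOn ℚ id (fourierExponents ⊥ ⊤ f)) (σ : ℝ) :
    Summable fun μ : ℝ => ‖lineCoeff hf μ 0‖ * Real.exp (μ * σ) := by
  have h : {μ : ℝ | coeff μ (lineFunction hf σ) ≠ 0} = fourierExponents ⊥ ⊤ f :=
    Set.ext fun μ => coeff_lineFunction_ne_zero_iff hf μ σ
  have h1 := summable_norm_coeff (F := lineFunction hf σ) (by rwa [h])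
  refine h1.congr fun μ => ?_
  rw [coeff_lineFunction, lineCoeff_eq hf μ σ 0, norm_mul, Complex.norm_exp_ofReal]

/-- An entire almost periodic function with linearly independent exponents is the sum of its
Dirichlet series. -/
theorem hasSum_dirichlet_series (hf : IsAlmostPeriodicInStrip ⊥ ⊤ f)
    (hΛ : LinearIndepOn ℚ id (fourierExponents ⊥ ⊤ f)) (s : ℂ) :
    HasSum (fun μ : ℝ => lineCoeff hf μ 0 * Complex.exp (μ * s)) (f s) := by
  have h : {μ : ℝ | coeff μ (lineFunction hf s.re) ≠ 0} = fourierExponents ⊥ ⊤ f :=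
    Set.ext fun μ => coeff_lineFunction_ne_zero_iff hf μ s.re
  have h1 := (isAP_lineFunction hf s.re).hasSum_coeff_smul_character (by rwa [h])
  have h2 := h1.mapL (BoundedContinuousFunction.evalCLM ℂ s.im)
  have hs : (s.re : ℂ) + Complex.I * s.im = s := by
    rw [mul_comm]; exact Complex.re_add_im s
  change HasSum _ (f (s.re + Complex.I * s.im)) at h2
  rw [hs] at h2
  refine (congrArg (fun g : ℝ → ℂ => HasSum g (f s)) (funext fun μ => ?_)).mp h2
  change coeff μ (lineFunction hf s.re) * character μ s.im = _
  rw [coeff_lineFunction, lineCoeff_eq hf μ s.re 0, character_apply, mul_assoc, ← Complex.exp_add]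
  congr 2
  nth_rw 3 [← hs]
  push_cast; ring

/-- Source of the contradiction both when a rotation vanishes identically and when the quotient in
`exists_zero` is constant. -/
lemma not_mem_fourierExponents_of_eq_exp (hf : IsAlmostPeriodicInStrip ⊥ ⊤ f) {ν : ℝ} {K : ℂ}
    (h : ∀ s, f s = K * Complex.exp (ν * s)) {μ : ℝ} (hμ : μ ≠ ν) :
    μ ∉ fourierExponents ⊥ ⊤ f := by
  classical
  rw [← coeff_lineFunction_ne_zero_iff hf μ 0, not_not]
  have e : lineFunction hf 0 = K • character ν := by
    ext t
    rw [lineFunction_apply, h, BoundedContinuousFunction.smul_apply, character_apply, smul_eq_mul]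
    congr 2
    push_cast; ring
  rw [e, map_smul, coeff_character, if_neg hμ, smul_zero]

end Entire

/-! ### Rotating one coefficient, Hurwitz, and the existence of a zero. -/

variable {f : ℂ → ℂ}

lemma exp_mul_le_add_exp (μ : ℝ) {a b x : ℝ} (hx : x ∈ Set.Icc a b) :
    Real.exp (μ * x) ≤ Real.exp (μ * a) + Real.exp (μ * b) := by
  have ha := Real.exp_pos (μ * a)
  have hb := Real.exp_pos (μ * b)
  rcases le_total 0 μ with h | h
  · have := Real.exp_le_exp.2 (mul_le_mul_of_nonneg_left hx.2 h)
    linarith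
  · have := Real.exp_le_exp.2 (mul_le_mul_of_nonpos_left hx.1 h)
    linarith

/-- The function obtained from `f` by multiplying its Dirichlet coefficient at `ν` by `z`. -/
def rotate (hf : IsAlmostPeriodicInStrip ⊥ ⊤ f) (ν : ℝ) (z s : ℂ) : ℂ :=
  f s + (z - 1) * (lineCoeff hf ν 0 * Complex.exp (ν * s))

lemma differentiable_rotate (hf : IsAlmostPeriodicInStrip ⊥ ⊤ f) (ν : ℝ) (z : ℂ) :
    Differentiable ℂ (rotate hf ν z) := by
  have := differentiable_of_isAlmostPeriodicInStrip hf
  unfold rotate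
  fun_prop

/-- Multiplying one Dirichlet coefficient by a number of modulus one gives a limit of vertical
translates. -/
theorem exists_translate_near_rotate (hf : IsAlmostPeriodicInStrip ⊥ ⊤ f)
    (hΛ : LinearIndepOn ℚ id (fourierExponents ⊥ ⊤ f)) (ν : ℝ) {z : ℂ} (hz : ‖z‖ = 1) (a b : ℝ)
    {ε : ℝ} (hε : 0 < ε) :
    ∃ τ : ℝ, ∀ s : ℂ, s.re ∈ Set.Icc a b → ‖f (s + Complex.I * τ) - rotate hf ν z s‖ ≤ ε := by
  classical
  set C : ℝ → ℂ := fun μ => lineCoeff hf μ 0 with hC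
  -- A summable majorant of the Dirichlet terms on the whole strip, obtained from the two boundary
  -- lines.
  set w : ℝ → ℝ := fun μ => ‖C μ‖ * (Real.exp (μ * a) + Real.exp (μ * b)) with hw
  have hw0 : ∀ μ, 0 ≤ w μ := fun μ => by positivity
  have hsum : Summable w := by
    simp only [hw, mul_add]
    exact (summable_norm_lineCoeff hf hΛ a).add (summable_norm_lineCoeff hf hΛ b)
  obtain ⟨W, hW⟩ := hsum
  have hW0 : 0 ≤ W := hW.nonneg hw0
  obtain ⟨S, hS⟩ := (Metric.tendsto_nhds.1 hW (ε / 4) (by positivity)).exists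
  have hS' : W - ∑ μ ∈ S, w μ ≤ ε / 4 := by
    rw [dist_comm, Real.dist_eq] at hS
    exact (le_abs_self _).trans hS.le
  set s' := S.filter fun μ => C μ ≠ 0 with hs'
  have hsub : (s' : Set ℝ) ⊆ fourierExponents ⊥ ⊤ f := fun μ hμ =>
    (mem_fourierExponents_iff hf μ).2 (Finset.mem_filter.1 hμ).2
  set δ := ε / (2 * (W + 1)) with hδ
  have hδ0 : 0 < δ := by positivity
  obtain ⟨τ, hτ⟩ := exists_character_near (intIndependent_of_subset hΛ s' hsub)
    (fun i => if (i : ℝ) = ν then z.arg else 0) hδ0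
  set ζ : ℝ → ℂ := fun μ => if μ = ν then z else 1 with hζ
  have hζ1 : ∀ μ, ‖ζ μ‖ = 1 := fun μ => by simp only [hζ]; split_ifs <;> simp [hz]
  have hnear : ∀ μ ∈ S, C μ ≠ 0 → ‖character μ τ - ζ μ‖ ≤ δ := by
    intro μ hμ hCμ
    have h1 := (hτ ⟨μ, Finset.mem_filter.2 ⟨hμ, hCμ⟩⟩).le
    have h2 : Complex.exp ((if μ = ν then z.arg else 0 : ℝ) * Complex.I) = ζ μ := by
      simp only [hζ]
      split_ifs with h
      · conv_rhs => rw [← Complex.norm_mul_exp_arg_mul_I z]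
        rw [hz]; simp
      · simp
    rw [← h2]; exact h1
  refine ⟨τ, fun s hs => ?_⟩
  have hone : HasSum (fun μ => if μ = ν then (z - 1) * (C ν * Complex.exp (ν * s)) else 0)
      ((z - 1) * (C ν * Complex.exp (ν * s))) := by
    have h2 := hasSum_single
      (f := fun μ => if μ = ν then (z - 1) * (C ν * Complex.exp (ν * s)) else 0) ν
      fun μ hμ => if_neg hμ
    simpa using h2
  have h1 := ((hasSum_dirichlet_series hf hΛ (s + Complex.I * τ)).sub
    ((hasSum_dirichlet_series hf hΛ s).add hone))
  -- On `S` Kronecker makes the phases agree up to `δ`; off `S` they differ by at most `2`. Each of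
  -- the two contributions is at most `ε / 2`.
  have hbd : HasSum (fun μ => w μ * δ + 2 * (w μ - if μ ∈ S then w μ else 0))
      (W * δ + 2 * (W - ∑ μ ∈ S, w μ)) := by
    refine (hW.mul_right δ).add ((hW.sub ?_).mul_left 2)
    have h2 : HasSum (fun μ => if μ ∈ S then w μ else 0) (∑ μ ∈ S, if μ ∈ S then w μ else 0) :=
      hasSum_sum_of_ne_finset_zero fun μ hμ => if_neg hμ
    rwa [Finset.sum_congr rfl fun μ hμ => if_pos hμ] at h2
  have hle := h1.norm_le_of_bounded hbd fun μ => ?_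
  · refine hle.trans ?_
    have : W * δ ≤ ε / 2 := by
      rw [hδ, mul_div_assoc', div_le_iff₀ (by positivity)]
      nlinarith
    linarith
  · have hexp : Complex.exp (μ * (s + Complex.I * τ)) = Complex.exp (μ * s) * character μ τ := by
      rw [character_apply, ← Complex.exp_add]; congr 1; push_cast; ring
    have e : lineCoeff hf μ 0 * Complex.exp (μ * (s + Complex.I * τ)) -
        (lineCoeff hf μ 0 * Complex.exp (μ * s) +
          if μ = ν then (z - 1) * (C ν * Complex.exp (ν * s)) else 0)
        = C μ * Complex.exp (μ * s) * (character μ τ - ζ μ) := by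
      rw [hexp]
      by_cases h : μ = ν
      · subst h; simp only [hζ, hC, if_true]; ring
      · simp only [hζ, hC, if_neg h]; ring
    rw [e, norm_mul]
    have hwμ : ‖C μ * Complex.exp (μ * s)‖ ≤ w μ := by
      rw [norm_mul, Complex.norm_exp, Complex.re_ofReal_mul]
      exact mul_le_mul_of_nonneg_left (exp_mul_le_add_exp μ hs) (norm_nonneg _)
    refine (mul_le_mul_of_nonneg_right hwμ (norm_nonneg _)).trans ?_
    by_cases hμ : μ ∈ S
    · rw [if_pos hμ, sub_self, mul_zero, add_zero]
      by_cases hCμ : C μ = 0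
      · simp [hw, hCμ]
      · exact mul_le_mul_of_nonneg_left (hnear μ hμ hCμ) (hw0 μ)
    · rw [if_neg hμ, sub_zero]
      have h2 : ‖character μ τ - ζ μ‖ ≤ 2 :=
        (norm_sub_le _ _).trans (by rw [norm_character_apply, hζ1]; norm_num)
      have := mul_le_mul_of_nonneg_left h2 (hw0 μ)
      have := mul_nonneg (hw0 μ) hδ0.le
      linarith

/-- A **Hurwitz type theorem**: an entire function that has an isolated zero cannot be approximated
uniformly on closed balls by entire functions without zeros. -/
lemma ne_zero_of_approximable {g : ℂ → ℂ} (hg : Differentiable ℂ g) (hne : ∃ s, g s ≠ 0)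
    (happ : ∀ (s : ℂ) (r : ℝ), ∀ ε > 0, ∃ k : ℂ → ℂ, Differentiable ℂ k ∧ (∀ s, k s ≠ 0) ∧
      ∀ y ∈ Metric.closedBall s r, ‖k y - g y‖ ≤ ε) (s₀ : ℂ) : g s₀ ≠ 0 := by
  intro hs₀
  have hga : AnalyticOnNhd ℂ g Set.univ := fun y _ => hg.analyticAt y
  rcases (hg.analyticAt s₀).eventually_eq_zero_or_eventually_ne_zero with h | h
  · obtain ⟨y, hy⟩ := hne
    exact hy (congrFun (hga.eq_of_eventuallyEq (g := fun _ => 0)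
      (fun y _ => analyticAt_const) h) y)
  · rw [eventually_nhdsWithin_iff, Metric.eventually_nhds_iff] at h
    obtain ⟨ρ, hρ, h⟩ := h
    set r := ρ / 2 with hr
    have hr0 : 0 < r := by positivity
    have hsphere : ∀ y ∈ Metric.sphere s₀ r, g y ≠ 0 := fun y hy => by
      rw [Metric.mem_sphere] at hy
      refine h (by rw [hy]; exact half_lt_self hρ) fun hys => ?_
      rw [Set.mem_singleton_iff.1 hys, dist_self] at hy
      exact hr0.ne hy
    obtain ⟨y₀, hy₀, hmin⟩ := (isCompact_sphere s₀ r).exists_isMinOn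
      (NormedSpace.sphere_nonempty.2 hr0.le) hg.continuous.norm.continuousOn
    set m := ‖g y₀‖ with hm
    have hm0 : 0 < m := norm_pos_iff.2 (hsphere y₀ hy₀)
    -- On the circle `‖k‖ ≥ 3 * m / 4`, while `‖k s₀‖ ≤ m / 4` at the centre: this contradicts the
    -- maximum principle for `1 / k`.
    obtain ⟨k, hk, hk0, hkg⟩ := happ s₀ r (m / 4) (by positivity)
    have hinv : Differentiable ℂ fun y => (k y)⁻¹ := hk.inv hk0
    have hfront : ∀ y ∈ frontier (Metric.ball s₀ r), ‖(k y)⁻¹‖ ≤ (3 * m / 4)⁻¹ := fun y hy => by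
      rw [frontier_ball s₀ hr0.ne'] at hy
      have h1 : m ≤ ‖g y‖ := hmin hy
      have h2 := hkg y (Metric.sphere_subset_closedBall hy)
      have h3 := norm_sub_norm_le (g y) (k y)
      rw [norm_sub_rev] at h3
      rw [norm_inv]
      exact inv_anti₀ (by positivity) (by linarith)
    have h1 := Complex.norm_le_of_forall_mem_frontier_norm_le Metric.isBounded_ball
      hinv.diffContOnCl hfront (subset_closure (Metric.mem_ball_self hr0))
    have h2 := hkg s₀ (Metric.mem_closedBall_self hr0.le)
    rw [hs₀, sub_zero] at h2
    rw [norm_inv] at h1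
    have h3 := (inv_le_inv₀ (norm_pos_iff.2 (hk0 s₀)) (by positivity)).1 h1
    linarith

/-- The zero-free vertical translates of `f` approximate the rotation on balls, and an identically
zero rotation would make `f` a single exponential at `ν`, contrary to the exponent `μ`. -/
lemma rotate_ne_zero (hf : IsAlmostPeriodicInStrip ⊥ ⊤ f)
    (hΛ : LinearIndepOn ℚ id (fourierExponents ⊥ ⊤ f)) (h0 : ∀ s, f s ≠ 0) {μ ν : ℝ}
    (hμ : μ ∈ fourierExponents ⊥ ⊤ f) (hμν : μ ≠ ν) {z : ℂ} (hz : ‖z‖ = 1) (s : ℂ) :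
    rotate hf ν z s ≠ 0 := by
  refine ne_zero_of_approximable (differentiable_rotate hf ν z) ?_ (fun y r ε hε => ?_) s
  · by_contra! hall
    refine not_mem_fourierExponents_of_eq_exp hf (ν := ν) (K := (1 - z) * lineCoeff hf ν 0)
      (fun y => ?_) hμν hμ
    have := hall y
    unfold rotate at this
    linear_combination this
  · obtain ⟨τ, hτ⟩ := exists_translate_near_rotate hf hΛ ν hz (y.re - r) (y.re + r) hε
    refine ⟨fun y => f (y + Complex.I * τ),
      (differentiable_of_isAlmostPeriodicInStrip hf).comp (by fun_prop), fun y => h0 _,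
      fun x hx => hτ x ?_⟩
    have h1 : |(x - y).re| ≤ r := (Complex.abs_re_le_norm _).trans (by
      rw [← dist_eq_norm]; exact hx)
    rw [Complex.sub_re, abs_le] at h1
    exact ⟨by linarith, by linarith⟩

/-- An entire almost periodic function with at least two exponents, all of them linearly
independent over `ℚ`, has a zero. -/
theorem exists_zero (hf : IsAlmostPeriodicInStrip ⊥ ⊤ f)
    (hΛ : LinearIndepOn ℚ id (fourierExponents ⊥ ⊤ f)) {μ ν : ℝ}
    (hμ : μ ∈ fourierExponents ⊥ ⊤ f) (hν : ν ∈ fourierExponents ⊥ ⊤ f) (hμν : μ ≠ ν) :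
    ∃ s, f s = 0 := by
  by_contra! h0
  have hfd := differentiable_of_isAlmostPeriodicInStrip hf
  have hc := (mem_fourierExponents_iff hf ν).1 hν
  set c := lineCoeff hf ν 0 with hcdef
  have hce : ∀ s : ℂ, c * Complex.exp (ν * s) ≠ 0 := fun s => mul_ne_zero hc (Complex.exp_ne_zero _)
  set h : ℂ → ℂ := fun s => f s / (c * Complex.exp (ν * s)) - 1 with hh
  have hhd : Differentiable ℂ h := (hfd.div (by fun_prop) hce).sub_const 1
  have hfh : ∀ s, f s = (1 + h s) * (c * Complex.exp (ν * s)) := fun s => by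
    simp only [hh]; rw [add_sub_cancel, div_mul_cancel₀ _ (hce s)]
  -- As `f = (1 + h) c exp (ν s)`, the rotation by `z` is `(h + z) c exp (ν s)`, which vanishes at
  -- `s` for `z = -h s`.
  have hne1 : ∀ s, ‖h s‖ ≠ 1 := fun s hs => by
    refine rotate_ne_zero hf hΛ h0 hμ hμν (z := -h s) (by rwa [norm_neg]) s ?_
    rw [rotate, hfh s]; ring
  -- By the intermediate value theorem `‖h‖` stays on one side of `1`; Liouville applies to `h` or
  -- to its inverse.
  have hconst : ∀ s, h s = h 0 := by
    rcases lt_or_gt_of_ne (hne1 0) with h1 | h1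
    · have hle : ∀ s, ‖h s‖ ≤ 1 := fun s => by
        by_contra! hlt
        obtain ⟨y, hy⟩ := mem_range_of_exists_le_of_exists_ge hhd.continuous.norm
          ⟨0, h1.le⟩ ⟨s, hlt.le⟩
        exact hne1 y hy
      exact fun s => hhd.apply_eq_apply_of_bounded
        (isBounded_iff_forall_norm_le.2 ⟨1, by rintro _ ⟨y, rfl⟩; exact hle y⟩) s 0
    · have hge : ∀ s, 1 ≤ ‖h s‖ := fun s => by
        by_contra! hlt
        obtain ⟨y, hy⟩ := mem_range_of_exists_le_of_exists_ge hhd.continuous.norm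
          ⟨s, hlt.le⟩ ⟨0, h1.le⟩
        exact hne1 y hy
      have hh0 : ∀ s, h s ≠ 0 := fun s => norm_pos_iff.1 (one_pos.trans_le (hge s))
      have hinv : Differentiable ℂ fun s => (h s)⁻¹ := hhd.inv hh0
      intro s
      refine inv_injective (hinv.apply_eq_apply_of_bounded
        (isBounded_iff_forall_norm_le.2 ⟨1, ?_⟩) s 0)
      rintro _ ⟨y, rfl⟩
      rw [norm_inv]
      exact inv_le_one_of_one_le₀ (hge y)
  refine not_mem_fourierExponents_of_eq_exp hf (ν := ν) (K := (1 + h 0) * c) (fun s => ?_) hμν hμ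
  rw [hfh s, hconst s]; ring

end AlmostPeriodic

end

theorem mainTheorem6 (f : ℂ → ℂ)
    (hf : IsAlmostPeriodicInStrip ⊥ ⊤ f)
    (hthree : 3 ≤ (fourierExponents ⊥ ⊤ f).encard)
    (hindep : LinearIndependent ℚ (fun μ : fourierExponents ⊥ ⊤ f => (μ : ℝ))) :
    (zeroProjectionSet ⊥ ⊤ f).Nonempty ∧ ∃ s : ℂ, f s = 0 := by
  obtain ⟨μ, ν, hμ, hν, hμν⟩ := Set.one_lt_encard_iff.1 (lt_of_lt_of_le (by norm_num) hthree)
  obtain ⟨s, hs⟩ := AlmostPeriodic.exists_zero hf hindep hμ hν hμν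
  exact ⟨⟨s.re, subset_closure ⟨s, AlmostPeriodic.mem_realInterval_bot_top s.re, hs, rfl⟩,
    AlmostPeriodic.mem_realInterval_bot_top s.re⟩, s, hs⟩
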